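/- **Nets.** An inhibitor-arc time Petri net (ITPN) consists of a set $P$ of places, a finite set $T$ of transitions, incidence functions $B,F:P\times T\to\mathbb N$ (backward, forward), an inhibitor function $IH:P\times T\to\mathbb N$, an initial marking $M^0:P\to\mathbb N$, and for each $t\in T$ a firing interval with end points $tmin(t)\in\mathbb Q_{\ge0}$, $tmax(t)\in\mathbb Q\cup\{\infty\}$, $tmin(t)\le tmax(t)$. For a marking $M$: $Te(M)=\{t:\forall p,\ B(p,t)\le M(p)\}$ (enabled), $Ti(M)=\{t\in Te(M):\exists p,\ 0<IH(p,t)\le M(p)\}$ (inhibited), $Ta(M)=Te(M)\setminus Ti(M)$ (activated). Firing $t_f\in Ta(M)$ yields $M^\uparrow(p)=M(p)-B(p,t_f)+F(p,t_f)$; $t\in Te(M^\uparrow)$ is newly enabled ($t\in New$) if $t\notin Te(M)$ or $\exists p,\ B(p,t_f)+B(p,t)>M(p)$, and persistent otherwise. Unknowns $\underline t$ (residual times) and $\underline{t_f^k}$ (time distance between firing points $k-1$ and $k$) take rational values; $\rceil X\lceil$ is the solution set of the system $X$. Coefficients of the approximate systems lie in $\mathbb Q\cup\{\infty\}$. **Exact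 graph $GR$.** Nodes are pairs $(M,D)$; the initial node is $(M^0,D^0)$, $D^0=\{tmin(t)\le\underline t\le tmax(t),\ t\in Te(M^0)\}$. There is an edge $(M,D)\xrightarrow{t_f}(M^\uparrow,D^\uparrow)$ iff $t_f\in Ta(M)$ and $D_a=D\wedge\bigwedge_{t\in Ta(M)}\underline{t_f}\le\underline t$ is consistent; $D^\uparrow$ is obtained from $D_a$ by substituting $\underline t=\underline{t_f}+\underline{t}'$ for $t$ persistent with $t\notin Ti(M)$ and $\underline t=\underline t'$ for $t$ persistent with $t\in Ti(M)$, eliminating all other old unknowns, and adding $tmin(t)\le\underline t'\le tmax(t)$ for $t\in New$. **DBM graph $\widetilde{GR}$.** Nodes are $(M,\widetilde D)$, $\widetilde D$ a matrix indexed by $Te(M)\cup\{\bullet\}$, standing for $-\widetilde D[t,\bullet]\le\underline t\le\widetilde D[\bullet,t]$ and $\underline{t'}-\underline t\le\widetilde D[t,t']$ ($t\ne t'$); diagonal entries are $0$. Initially the marking is $M^0$ and $\widetilde{D^0}[\bullet,t]=tmax(t)$, $\widetilde{D^0}[t,\bullet]=-tmin(t)$, $\widetilde{D^0}[t,t']=tmax(t')-tmin(t)$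 for $t\neq t'$. Put $\widetilde\beta[x]=\min_{t\in Ta(M)}\widetilde D[x,t]$. The transition $t_f$ is firable iff $t_f\in Ta(M)$ and $\widetilde\beta[t_f]\ge0$. The next matrix is: - $t\in New$: $\widetilde{D^\uparrow}[\bullet,t]=tmax(t)$, $\widetilde{D^\uparrow}[t,\bullet]=-tmin(t)$; - $t$ persistent, $t\in Ti(M)$: $\widetilde{D^\uparrow}[\bullet,t]=\min(\widetilde D[\bullet,t],\widetilde D[t_f,t]+\widetilde\beta[\bullet])$, $\widetilde{D^\uparrow}[t,\bullet]=\min(\widetilde D[t,\bullet],\widetilde D[t_f,\bullet]+\widetilde\beta[t])$; - $t$ persistent, $t\notin Ti(M)$: $\widetilde{D^\uparrow}[\bullet,t]=\widetilde D[t_f,t]$, $\widetilde{D^\uparrow}[t,\bullet]=\widetilde\beta[t]$; - $t_1\ne t_2$, one of them in $New$: $\widetilde{D^\uparrow}[t_1,t_2]=\widetilde{D^\uparrow}[\bullet,t_2]+\widetilde{D^\uparrow}[t_1,\bullet]$; both persistent: $\widetilde{D^\uparrow}[t_1,t_2]=\min(x,\ \widetilde{D^\uparrow}[\bullet,t_2]+\widetilde{D^\uparrow}[t_1,\bullet])$,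 where $x=\widetilde D[t_1,t_2]+\widetilde D[t_f,\bullet]$ if only $t_1$ is in $Ti(M)$, $x=\widetilde D[t_1,t_2]+\widetilde\beta[\bullet]$ if only $t_2$ is in $Ti(M)$, and $x=\widetilde D[t_1,t_2]$ otherwise. **Points.** Along $S=(t_f^1,\dots,t_f^n)$ with markings $M^0,\dots,M^n$, let for $t\in Te(M^n)$: $Ne^n(t)$ be the firing point at which $t$ was last newly enabled ($0$ initially), $Ni^n(t)$ (resp. $Na^n(t)$) the last point, since then, at which $t$ became inhibited (resp. activated), at its enabling or by passing from activated to inhibited (resp. conversely), and $-1$ if there is none. $Point^n$ is the set of values of $Ne^n,Ni^n,Na^n$ on $Te(M^n)$, without $-1$. **Time distance systems.** With $T_{i,n}=\underline{t_f^{i+1}}+\dots+\underline{t_f^n}$, a time distance system at point $n$ with coefficients $A$ consists of the constraints $-A[n,i]\le T_{i,n}\le A[i,n]$ for $i\in Point^n$ and $-A[t,i]\le T_{i,n}+\underline t\le A[i,t]$ for $i\in Point^n\cup\{n\}$, $t\in Te(M^n)$. The exact system $DS^n$ of a sequence $S$ firable in $GR$ has as coefficients $DS^n[i,n]$, $DS^n[i,t]$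 the suprema of $T_{i,n}$, $T_{i,n}+\underline t$, and as $-DS^n[n,i]$, $-DS^n[t,i]$ the infima of the same quantities, over all timed runs along $S$ (choices of $\underline{t_f^1},\dots,\underline{t_f^n}$ and final residual times $\underline t$ obtained by starting from a solution of $D^0$ and firing $t_f^1,\dots,t_f^n$ as in $GR$). **Time distance based graph $\widetilde{GRc}$.** Nodes reached by $S$ are $(M^n,Ne^n,Ni^n,Na^n,\widetilde{DS^n},\widetilde{D_c^n})$ (together with the earlier $\widetilde{DS^k}$, $k<n$, of the path). The system $\widetilde{D_c^n}$ stands for $\underline{t'}-\underline t\le\widetilde{D_c^n}[t,t']$ ($t\ne t'$; the diagonal is $0$) and $-\widetilde{DS^n}[t,n]\le\underline t\le\widetilde{DS^n}[n,t]$, for $t,t'\in Te(M^n)$. Initially $\widetilde{DS^0}[0,0]=0$, $\widetilde{DS^0}[0,t]=tmax(t)$, $\widetilde{DS^0}[t,0]=-tmin(t)$, $\widetilde{D_c^0}[t,t']=tmax(t')-tmin(t)$ for $t\ne t'$. Put $\widetilde{\beta_c^{n}}[t]=\min_{t'\in Ta(M^{n})}\widetilde{D_c^{n}}[t,t']$ and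 $\lambda^{n}[i]=\min_{t\in Ta(M^{n})}\widetilde{DS^{n}}[i,t]$. The transition $t_f=t_f^n$ is firable from the node at point $n-1$ iff $t_f\in Ta(M^{n-1})$ and $\widetilde{\beta_c^{n-1}}[t_f]\ge0$. The next node is computed as follows ($i\in Point^n\setminus\{n\}$, $t,t'\in Te(M^n)$; we write $DS,D$ for $\widetilde{DS},\widetilde{D_c}$, and $\beta$ for $\widetilde{\beta_c}$): - $DS^n[i,n]=\lambda^{n-1}[i]$, $DS^n[n,i]=DS^{n-1}[t_f,i]$, $DS^n[n,n]=0$. - $t\in New$: $DS^n[i,t]=DS^n[i,n]+tmax(t)$, $DS^n[t,i]=DS^n[n,i]-tmin(t)$, $DS^n[n,t]=tmax(t)$, $DS^n[t,n]=-tmin(t)$. - $t$ persistent, $t\notin Ti(M^{n-1})$, with $r=Ne^n(t)$, $s=Ni^{n-1}(t)$, $p=Na^n(t)$: $DS^n[i,t]$ is the minimum of $DS^{n-1}[i,t]$, of $DS^n[i,n]+DS^{n-1}[n-1,t]+DS^{n-1}[t_f,n-1]$, and of $DS^s[i,t]+\lambda^{n-1}[s]+DS^n[n,p]$ if $0\le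 i\le s\le p$, or $DS^i[i,t]+DS^n[i,n]+DS^n[n,p]$ if $0\le s\le i\le p$; $DS^n[t,i]$ is the minimum of $DS^{n-1}[t,i]$, of $DS^n[n,i]+\min(0,DS^{n-1}[t,n-1]+\lambda^{n-1}[n-1])$, and of $DS^s[t,i]+DS^{n-1}[t_f,s]+DS^n[p,n]$ if $0\le i\le s\le p$, or $DS^i[t,i]+DS^n[n,i]+DS^n[p,n]$ if $0\le s\le i\le p$; $DS^n[t,n]=\min(\beta^{n-1}[t],0,DS^n[t,r]+DS^n[r,n])$; $DS^n[n,t]=\min(D^{n-1}[t_f,t],DS^n[r,t]+DS^n[n,r])$. - $t$ persistent, $t\in Ti(M^{n-1})$, with $s=Ni^n(t)$, $r=Ne^n(t)$: $DS^n[i,t]$ is the minimum of $DS^{n-1}[i,t]+\lambda^{n-1}[n-1]$ and of $DS^s[i,t]+DS^n[s,n]$ if $i\le s$, $DS^i[i,t]+DS^n[i,n]$ if $s\le i$; $DS^n[t,i]$ is the minimum of $DS^{n-1}[t,i]+DS^{n-1}[t_f,n-1]$ and of $DS^s[t,i]+DS^n[n,s]$ if $i\le s$, $DS^i[t,i]+DS^n[n,i]$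 if $s\le i$; $DS^n[n,t]=\min(DS^n[r,t]+DS^n[n,r],\,DS^{n-1}[n-1,t],\,D^{n-1}[t_f,t]+\lambda^{n-1}[n-1])$; $DS^n[t,n]=\min(0,\,DS^n[t,r]+DS^n[r,n],\,DS^{n-1}[t,n-1],\,DS^{n-1}[t_f,n-1]+\beta^{n-1}[t])$. - $t\ne t'$, one of them in $New$: $D^n[t,t']=DS^n[n,t']+DS^n[t,n]$; both persistent: $D^n[t,t']=\min(x,\alpha)$ with $\alpha=\min_{i\in Point^n\cup\{n\}}(DS^n[i,t']+DS^n[t,i])$ and $x=D^{n-1}[t,t']+DS^{n-1}[t_f,n-1]$ if only $t$ is in $Ti(M^{n-1})$, $x=D^{n-1}[t,t']+\lambda^{n-1}[n-1]$ if only $t'$ is in $Ti(M^{n-1})$, $x=D^{n-1}[t,t']$ otherwise. **Theorem 1.** For every ITPN, $\widetilde{GRc}$ is an over-approximation of $GR$, and $\widetilde{GR}$ is an over-approximation of $\widetilde{GRc}$: 1. $\rceil D^0\lceil=\rceil\widetilde{D_c^0}\lceil=\rceil\widetilde{D^0}\lceil$ and $\rceil DS^0\lceil=\rceil\widetilde{DS^0}\lceil$.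 2. Every sequence $S=(t_f^1,\dots,t_f^n)$ firable in $GR$ is firable in $\widetilde{GRc}$; the nodes reached by $S$ have the same marking, and $\rceil D^n\lceil\subseteq\rceil\widetilde{D_c^n}\lceil$, $\rceil DS^n\lceil\subseteq\rceil\widetilde{DS^n}\lceil$. 3. Every sequence $S$ firable in $\widetilde{GRc}$ is firable in $\widetilde{GR}$; the nodes reached by $S$ have the same marking, and $\rceil\widetilde{D_c^n}\lceil\subseteq\rceil\widetilde{D^n}\lceil$. In particular, every sequence firable in $GR$ is firable in all three graphs, with $\rceil D^n\lceil\subseteq\rceil\widetilde{D_c^n}\lceil\subseteq\rceil\widetilde{D^n}\lceil$. -/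

import Mathlib

noncomputable section

/-- A time Petri net with inhibitor arcs over places `P` and transitions `T`. `tmax t = ⊤` encodes
an unbounded firing interval; there is an inhibitor arc from `p` to `t` iff `inh p t ≠ 0`. -/
structure ITPN (P T : Type*) where
  /-- backward incidence function `B` -/
  pre : P → T → ℕ
  /-- forward incidence function `F` -/
  post : P → T → ℕ
  /-- inhibitor arc function `IH` -/
  inh : P → T → ℕ
  /-- initial marking `M⁰` -/
  M0 : P → ℕ
  tmin : T → ℚ
  tmax : T → WithTop ℚ
  tmin_nonneg : ∀ t, 0 ≤ tmin t
  tmin_le_tmax : ∀ t, (tmin t : WithTop ℚ) ≤ tmax t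

/-- A rooted labelled transition graph on nodes of type `C`. -/
structure RootedGraph (C L : Type*) where
  root : C
  step : C → L → C → Prop

/-- `G.Path S E`: firing the label sequence `S` from the root leads to `E`. -/
inductive RootedGraph.Path {C L : Type*} (G : RootedGraph C L) : List L → C → Prop
  | nil : G.Path [] G.root
  | snoc {S : List L} {E E' : C} {t : L} :
      G.Path S E → G.step E t E' → G.Path (S ++ [t]) E'

/-- The sequence `S` is firable in `G`. -/
def RootedGraph.Firable {C L : Type*} (G : RootedGraph C L) (S : List L) : Prop :=
  ∃ E, G.Path S E

namespace ITPN

variable {P T : Type*} [Fintype T] (N : ITPN P T)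

/-! ### Markings -/

open scoped Classical in
/-- Transitions enabled for `M`. -/
def Te (M : P → ℕ) : Finset T := Finset.univ.filter fun t => ∀ p, N.pre p t ≤ M p

open scoped Classical in
/-- Transitions inhibited for `M` (enabled, and some inhibitor arc is active). -/
def Ti (M : P → ℕ) : Finset T := (N.Te M).filter fun t => ∃ p, 0 < N.inh p t ∧ N.inh p t ≤ M p

open scoped Classical in
/-- Transitions activated for `M` (enabled and not inhibited). -/
def Ta (M : P → ℕ) : Finset T := (N.Te M).filter fun t => t ∉ N.Ti M

/-- Marking reached by firing `tf`. -/
def fire (M : P → ℕ) (tf : T) : P → ℕ := fun p => M p - N.pre p tf + N.post p tf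

/-- `t₁` and `t₂` are conflicting for `M`. -/
def Conf (M : P → ℕ) (t₁ t₂ : T) : Prop := ∃ p, M p < N.pre p t₁ + N.pre p t₂

open scoped Classical in
/-- Transitions newly enabled by firing `tf` from `M`. The other transitions that are enabled for
`N.fire M tf` are the persistent ones. -/
def New (M : P → ℕ) (tf : T) : Finset T :=
  (N.Te (N.fire M tf)).filter fun t => t ∉ N.Te M ∨ N.Conf M tf t

/-! ### The exact state class graph

A system of inequalities on the residual times of the transitions of `Te M` is represented by its
set of solutions. A valuation is a function `T → ℚ`; its values outside `Te M` are unconstrained. -/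

/-- Solutions of the initial system `D⁰`. -/
def initSol : Set (T → ℚ) :=
  {θ | ∀ t ∈ N.Te N.M0, N.tmin t ≤ θ t ∧ (θ t : WithTop ℚ) ≤ N.tmax t}

/-- `tf` can be fired first from the valuation `θ`. -/
def FiresFirst (M : P → ℕ) (tf : T) (θ : T → ℚ) : Prop := ∀ t ∈ N.Ta M, θ tf ≤ θ t

open scoped Classical in
/-- `θ'` is a valuation obtained from `θ` by firing `tf` at time `θ tf` from the marking `M`. -/
def Succ (M : P → ℕ) (tf : T) (θ θ' : T → ℚ) : Prop :=
  N.FiresFirst M tf θ ∧ ∀ t ∈ N.Te (N.fire M tf),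
    if t ∈ N.New M tf then N.tmin t ≤ θ' t ∧ (θ' t : WithTop ℚ) ≤ N.tmax t
    else if t ∈ N.Ti M then θ' t = θ t
    else θ' t = θ t - θ tf

/-- A class `(M, D)`, with `D` given by its set of solutions. -/
structure StateClass (P T : Type*) where
  M : P → ℕ
  D : Set (T → ℚ)

/-- The exact state class graph `GR`. -/
def GR : RootedGraph (StateClass P T) T where
  root := ⟨N.M0, N.initSol⟩
  step E tf E' :=
    tf ∈ N.Ta E.M ∧ (∃ θ ∈ E.D, N.FiresFirst E.M tf θ) ∧
    E' = ⟨N.fire E.M tf, {θ' | ∃ θ ∈ E.D, N.Succ E.M tf θ θ'}⟩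

/-! ### The classical DBM over-approximation -/

/-- A difference bound matrix, indexed by the transitions and the instant `• = none`. Only the
entries indexed by `Te M` and `•` are meaningful. -/
abbrev DBM (T : Type*) := Option T → Option T → WithTop ℚ

/-- Solutions of a DBM system for the marking `M`. -/
def dbmSol (M : P → ℕ) (D : DBM T) : Set (T → ℚ) :=
  {θ | (∀ t ∈ N.Te M, ((-θ t : ℚ) : WithTop ℚ) ≤ D (some t) none ∧
          (θ t : WithTop ℚ) ≤ D none (some t)) ∧
       ∀ t ∈ N.Te M, ∀ t' ∈ N.Te M, t ≠ t' →
          ((θ t' - θ t : ℚ) : WithTop ℚ) ≤ D (some t) (some t')}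

open scoped Classical in
def dbmInit : DBM T
  | none, none => 0
  | none, some t => N.tmax t
  | some t, none => ((-N.tmin t : ℚ) : WithTop ℚ)
  | some t, some t' => if t = t' then 0 else N.tmax t' + ((-N.tmin t : ℚ) : WithTop ℚ)

/-- `β[x]`, the minimum of `D[x,t]` over the activated transitions `t`. -/
def dbmBeta (M : P → ℕ) (D : DBM T) (x : Option T) : WithTop ℚ :=
  (N.Ta M).inf fun t => D x (some t)

open scoped Classical in
/-- The new coefficient `[•,t]`. -/
def dbmUpper (M : P → ℕ) (D : DBM T) (tf t : T) : WithTop ℚ :=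
  if t ∈ N.New M tf then N.tmax t
  else if t ∈ N.Ti M then
    min (D none (some t)) (D (some tf) (some t) + N.dbmBeta M D none)
  else D (some tf) (some t)

open scoped Classical in
/-- The new coefficient `[t,•]`. -/
def dbmLower (M : P → ℕ) (D : DBM T) (tf t : T) : WithTop ℚ :=
  if t ∈ N.New M tf then ((-N.tmin t : ℚ) : WithTop ℚ)
  else if t ∈ N.Ti M then
    min (D (some t) none) (D (some tf) none + N.dbmBeta M D (some t))
  else N.dbmBeta M D (some t)

open scoped Classical in
/-- The new coefficient `[t₁,t₂]` for persistent `t₁ ≠ t₂`, as deduced from the old one. -/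
def dbmCross (M : P → ℕ) (D : DBM T) (tf t₁ t₂ : T) : WithTop ℚ :=
  if t₁ ∈ N.Ti M ∧ t₂ ∉ N.Ti M then D (some t₁) (some t₂) + D (some tf) none
  else if t₁ ∉ N.Ti M ∧ t₂ ∈ N.Ti M then D (some t₁) (some t₂) + N.dbmBeta M D none
  else D (some t₁) (some t₂)

open scoped Classical in
/-- The DBM computed after firing `tf`. -/
def dbmNext (M : P → ℕ) (D : DBM T) (tf : T) : DBM T
  | none, none => 0
  | none, some t => N.dbmUpper M D tf t
  | some t, none => N.dbmLower M D tf t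
  | some t₁, some t₂ =>
      if t₁ = t₂ then 0
      else if t₁ ∈ N.New M tf ∨ t₂ ∈ N.New M tf then
        N.dbmUpper M D tf t₂ + N.dbmLower M D tf t₁
      else min (N.dbmCross M D tf t₁ t₂) (N.dbmUpper M D tf t₂ + N.dbmLower M D tf t₁)

/-- A class of the classical DBM over-approximation. -/
structure DBMClass (P T : Type*) where
  M : P → ℕ
  D : DBM T

/-- The DBM over-approximated graph `GR~`. -/
def GRdbm : RootedGraph (DBMClass P T) T where
  root := ⟨N.M0, N.dbmInit⟩
  step E tf E' :=
    tf ∈ N.Ta E.M ∧ 0 ≤ N.dbmBeta E.M E.D (some tf) ∧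
    E' = ⟨N.fire E.M tf, N.dbmNext E.M E.D tf⟩

/-! ### Firing points -/

/-- The firing point `n`, its marking and the last enabling, inhibiting and activating points of the
enabled transitions; `none` stands for the value `-1` of `Ni` and `Na`. -/
structure FiringPoint (P T : Type*) where
  n : ℕ
  M : P → ℕ
  Ne : T → ℕ
  Ni : T → Option ℕ
  Na : T → Option ℕ

open scoped Classical in
def initPoint : FiringPoint P T where
  n := 0
  M := N.M0
  Ne := fun _ => 0
  Ni := fun t => if t ∈ N.Ti N.M0 then some 0 else none
  Na := fun t => if t ∈ N.Ta N.M0 then some 0 else none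

open scoped Classical in
def nextPoint (c : FiringPoint P T) (tf : T) : FiringPoint P T where
  n := c.n + 1
  M := N.fire c.M tf
  Ne := fun t => if t ∈ N.New c.M tf then c.n + 1 else c.Ne t
  Ni := fun t =>
    if t ∈ N.New c.M tf then (if t ∈ N.Ti (N.fire c.M tf) then some (c.n + 1) else none)
    else if t ∈ N.Ta c.M ∧ t ∈ N.Ti (N.fire c.M tf) then some (c.n + 1)
    else c.Ni t
  Na := fun t =>
    if t ∈ N.New c.M tf then (if t ∈ N.Ta (N.fire c.M tf) then some (c.n + 1) else none)
    else if t ∈ N.Ta (N.fire c.M tf) ∧ t ∈ N.Ti c.M then some (c.n + 1)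
    else c.Na t

/-- The firing point reached by the sequence `S`. -/
def pointOf (S : List T) : FiringPoint P T := S.foldl N.nextPoint N.initPoint

open scoped Classical in
/-- The set `Pointⁿ`. All the recorded points are at most `n`. -/
def Point (c : FiringPoint P T) : Finset ℕ :=
  (Finset.range (c.n + 1)).filter fun k =>
    ∃ t ∈ N.Te c.M, c.Ne t = k ∨ c.Ni t = some k ∨ c.Na t = some k

/-! ### Time distance systems -/

/-- The four matrices of a time distance system: `maxPt i = DS[i,n]`, `minPt i = DS[n,i]`,
`maxTr i t = DS[i,t]`, `minTr t i = DS[t,i]`. The `min` matrices hold opposites of minima. -/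
structure DistMatrix (T R : Type*) where
  maxPt : ℕ → R
  minPt : ℕ → R
  maxTr : ℕ → T → R
  minTr : T → ℕ → R

/-- The time elapsed between the firing points `i` and `n`, where `τ k` is the time distance between
the firing points `k - 1` and `k`. -/
def elapsed (τ : ℕ → ℚ) (i n : ℕ) : ℚ := ∑ k ∈ Finset.Ioc i n, τ k

/-- A rational number as an extended real. -/
def ofRat (q : ℚ) : EReal := ((q : ℝ) : EReal)

/-- An element of `ℚ ∪ {∞}` as an extended real. -/
def ofBound : WithTop ℚ → EReal
  | ⊤ => ⊤
  | (q : ℚ) => ofRat q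

/-- Change of coefficients. -/
def DistMatrix.map {T R R' : Type*} (f : R → R') (A : DistMatrix T R) : DistMatrix T R' where
  maxPt i := f (A.maxPt i)
  minPt i := f (A.minPt i)
  maxTr i t := f (A.maxTr i t)
  minTr t i := f (A.minTr t i)

/-- The solutions of the time distance system with coefficients `A` at the firing point `c`, in the
variables `τ 1, …, τ n` (firing time distances) and `θ t` (residual times). -/
def distSol (c : FiringPoint P T) (A : DistMatrix T EReal) : Set ((ℕ → ℚ) × (T → ℚ)) :=
  {x | (∀ i ∈ N.Point c,
          ofRat (-elapsed x.1 i c.n) ≤ A.minPt i ∧ ofRat (elapsed x.1 i c.n) ≤ A.maxPt i) ∧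
       ∀ i ∈ insert c.n (N.Point c), ∀ t ∈ N.Te c.M,
          ofRat (-(elapsed x.1 i c.n + x.2 t)) ≤ A.minTr t i ∧
          ofRat (elapsed x.1 i c.n + x.2 t) ≤ A.maxTr i t}

/-- `N.TimedRun S τ θ`: firing the sequence `S` with the firing time distances `τ 1, …, τ n` leads to
the residual times `θ`. -/
inductive TimedRun : List T → (ℕ → ℚ) → (T → ℚ) → Prop
  | nil (τ : ℕ → ℚ) {θ : T → ℚ} : θ ∈ N.initSol → TimedRun [] τ θ
  | snoc {S : List T} {tf : T} {τ τ' : ℕ → ℚ} {θ θ' : T → ℚ} :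
      TimedRun S τ θ → tf ∈ N.Ta (N.pointOf S).M → N.Succ (N.pointOf S).M tf θ θ' →
      (∀ k ∈ Finset.Icc 1 S.length, τ' k = τ k) → τ' (S.length + 1) = θ tf →
      TimedRun (S ++ [tf]) τ' θ'

/-- The supremum of `f` over all timed runs along `S`. -/
def supRuns (S : List T) (f : (ℕ → ℚ) → (T → ℚ) → ℚ) : EReal :=
  ⨆ (τ : ℕ → ℚ) (θ : T → ℚ) (_ : N.TimedRun S τ θ), ofRat (f τ θ)

/-- The coefficients of the exact time distance system of the sequence `S`: the maximal time
distances, and the opposites of the minimal ones, over all timed runs along `S`. -/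
def exactDS (S : List T) : DistMatrix T EReal where
  maxPt i := N.supRuns S fun τ _ => elapsed τ i S.length
  minPt i := N.supRuns S fun τ _ => -elapsed τ i S.length
  maxTr i t := N.supRuns S fun τ θ => elapsed τ i S.length + θ t
  minTr t i := N.supRuns S fun τ θ => -(elapsed τ i S.length + θ t)

/-! ### The time distance based approximation -/

/-- A class of the time distance based approximation. `DS k` is the approximated time distance system
at the firing point `k ≤ n` of the fired sequence; `Dc t t'` bounds `θ t' - θ t`. -/
structure DistClass (P T : Type*) extends FiringPoint P T where
  DS : ℕ → DistMatrix T (WithTop ℚ)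
  Dc : T → T → WithTop ℚ

/-- The coefficients of the system `DS⁰`. -/
def initDS : DistMatrix T (WithTop ℚ) where
  maxPt _ := 0
  minPt _ := 0
  maxTr _ t := N.tmax t
  minTr t _ := ((-N.tmin t : ℚ) : WithTop ℚ)

open scoped Classical in
def distInit : DistClass P T where
  toFiringPoint := N.initPoint
  DS := fun _ => N.initDS
  Dc := fun t t' => if t = t' then 0 else N.tmax t' + ((-N.tmin t : ℚ) : WithTop ℚ)

/-- Solutions of the system `D_c~`, including the bounds on residual times that are stored in the
current time distance system. -/
def distClassSol (E : DistClass P T) : Set (T → ℚ) :=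
  {θ | (∀ t ∈ N.Te E.M, ((-θ t : ℚ) : WithTop ℚ) ≤ (E.DS E.n).minTr t E.n ∧
          (θ t : WithTop ℚ) ≤ (E.DS E.n).maxTr E.n t) ∧
       ∀ t ∈ N.Te E.M, ∀ t' ∈ N.Te E.M, t ≠ t' →
          ((θ t' - θ t : ℚ) : WithTop ℚ) ≤ E.Dc t t'}

/-! In the following definitions `E` is the class at the firing point `n - 1 = E.n`, and `tf` is the
transition fired from it. -/

section Next

variable (E : DistClass P T) (tf : T)

/-- `β_c[t]` at the point `n - 1`. -/
def distBeta (t : T) : WithTop ℚ := (N.Ta E.M).inf fun t' => E.Dc t t'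

/-- `λ[i]` at the point `n - 1`. -/
def distLambda (i : ℕ) : WithTop ℚ := (N.Ta E.M).inf fun t => (E.DS E.n).maxTr i t

open scoped Classical in
/-- `DSⁿ[i,n]`. -/
def newMaxPt (i : ℕ) : WithTop ℚ := if i = E.n + 1 then 0 else N.distLambda E i

open scoped Classical in
/-- `DSⁿ[n,i]`. -/
def newMinPt (i : ℕ) : WithTop ℚ := if i = E.n + 1 then 0 else (E.DS E.n).minTr tf i

/-- Candidate for `DSⁿ[i,t]` (`t` activated at `n - 1`) from the last inhibition of `t`. -/
def histMaxAct (i : ℕ) (t : T) : WithTop ℚ :=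
  match E.Ni t, (N.nextPoint E.toFiringPoint tf).Na t with
  | some s, some p =>
      if i ≤ s ∧ s ≤ p then (E.DS s).maxTr i t + N.distLambda E s + newMinPt E tf p
      else if s ≤ i ∧ i ≤ p then
        (E.DS i).maxTr i t + N.newMaxPt E i + newMinPt E tf p
      else ⊤
  | _, _ => ⊤

/-- Candidate for `DSⁿ[t,i]` (`t` activated at `n - 1`) from the last inhibition of `t`. -/
def histMinAct (i : ℕ) (t : T) : WithTop ℚ :=
  match E.Ni t, (N.nextPoint E.toFiringPoint tf).Na t with
  | some s, some p =>
      if i ≤ s ∧ s ≤ p then (E.DS s).minTr t i + (E.DS E.n).minTr tf s + N.newMaxPt E p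
      else if s ≤ i ∧ i ≤ p then
        (E.DS i).minTr t i + newMinPt E tf i + N.newMaxPt E p
      else ⊤
  | _, _ => ⊤

/-- Candidate for `DSⁿ[i,t]` (`t` inhibited at `n - 1`) from the last inhibition of `t`. -/
def histMaxInh (i : ℕ) (t : T) : WithTop ℚ :=
  match (N.nextPoint E.toFiringPoint tf).Ni t with
  | some s =>
      if i ≤ s then (E.DS s).maxTr i t + N.newMaxPt E s
      else (E.DS i).maxTr i t + N.newMaxPt E i
  | none => ⊤

/-- Candidate for `DSⁿ[t,i]` (`t` inhibited at `n - 1`) from the last inhibition of `t`. -/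
def histMinInh (i : ℕ) (t : T) : WithTop ℚ :=
  match (N.nextPoint E.toFiringPoint tf).Ni t with
  | some s =>
      if i ≤ s then (E.DS s).minTr t i + newMinPt E tf s
      else (E.DS i).minTr t i + newMinPt E tf i
  | none => ⊤

open scoped Classical in
/-- `DSⁿ[i,t]` for a persistent `t` and `i < n`. -/
def persMax (i : ℕ) (t : T) : WithTop ℚ :=
  if t ∈ N.Ti E.M then
    min (N.histMaxInh E tf i t) ((E.DS E.n).maxTr i t + N.distLambda E E.n)
  else
    min (N.histMaxAct E tf i t)
      (min ((E.DS E.n).maxTr i t)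
        (N.newMaxPt E i + (E.DS E.n).maxTr E.n t + (E.DS E.n).minTr tf E.n))

open scoped Classical in
/-- `DSⁿ[t,i]` for a persistent `t` and `i < n`. -/
def persMin (i : ℕ) (t : T) : WithTop ℚ :=
  if t ∈ N.Ti E.M then
    min (N.histMinInh E tf i t) ((E.DS E.n).minTr t i + (E.DS E.n).minTr tf E.n)
  else
    min (N.histMinAct E tf i t)
      (min ((E.DS E.n).minTr t i)
        (newMinPt E tf i + min 0 ((E.DS E.n).minTr t E.n + N.distLambda E E.n)))

open scoped Classical in
/-- `DSⁿ[n,t]` for a persistent `t`; its enabling point is `E.Ne t`. -/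
def persMaxNow (t : T) : WithTop ℚ :=
  if t ∈ N.Ti E.M then
    min (N.persMax E tf (E.Ne t) t + newMinPt E tf (E.Ne t))
      (min ((E.DS E.n).maxTr E.n t) (E.Dc tf t + N.distLambda E E.n))
  else
    min (E.Dc tf t) (N.persMax E tf (E.Ne t) t + newMinPt E tf (E.Ne t))

open scoped Classical in
/-- `DSⁿ[t,n]` for a persistent `t`; its enabling point is `E.Ne t`. -/
def persMinNow (t : T) : WithTop ℚ :=
  if t ∈ N.Ti E.M then
    min (min 0 (N.persMin E tf (E.Ne t) t + N.newMaxPt E (E.Ne t)))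
      (min ((E.DS E.n).minTr t E.n) ((E.DS E.n).minTr tf E.n + N.distBeta E t))
  else
    min (N.distBeta E t) (min 0 (N.persMin E tf (E.Ne t) t + N.newMaxPt E (E.Ne t)))

open scoped Classical in
/-- The approximated time distance system `DSⁿ`. -/
def nextDS : DistMatrix T (WithTop ℚ) where
  maxPt i := N.newMaxPt E i
  minPt i := newMinPt E tf i
  maxTr i t :=
    if t ∈ N.New E.M tf then N.newMaxPt E i + N.tmax t
    else if i = E.n + 1 then N.persMaxNow E tf t
    else N.persMax E tf i t
  minTr t i :=
    if t ∈ N.New E.M tf then newMinPt E tf i + ((-N.tmin t : ℚ) : WithTop ℚ)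
    else if i = E.n + 1 then N.persMinNow E tf t
    else N.persMin E tf i t

/-- `αⁿ[t,t']`. -/
def distAlpha (t t' : T) : WithTop ℚ :=
  (insert (E.n + 1) (N.Point (N.nextPoint E.toFiringPoint tf))).inf fun i =>
    (N.nextDS E tf).maxTr i t' + (N.nextDS E tf).minTr t i

open scoped Classical in
/-- The coefficient `[t,t']` for persistent `t ≠ t'`, as deduced from the one at the point `n - 1`. -/
def distCross (t t' : T) : WithTop ℚ :=
  if t ∈ N.Ti E.M ∧ t' ∉ N.Ti E.M then E.Dc t t' + (E.DS E.n).minTr tf E.n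
  else if t ∉ N.Ti E.M ∧ t' ∈ N.Ti E.M then E.Dc t t' + N.distLambda E E.n
  else E.Dc t t'

open scoped Classical in
/-- The system `D_cⁿ`. -/
def nextDc (t t' : T) : WithTop ℚ :=
  if t = t' then 0
  else if t ∈ N.New E.M tf ∨ t' ∈ N.New E.M tf then
    (N.nextDS E tf).maxTr (E.n + 1) t' + (N.nextDS E tf).minTr t (E.n + 1)
  else min (N.distCross E tf t t') (N.distAlpha E tf t t')

open scoped Classical in
/-- The class obtained by firing `tf`. -/
def distNext : DistClass P T where
  toFiringPoint := N.nextPoint E.toFiringPoint tf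
  DS := Function.update E.DS (E.n + 1) (N.nextDS E tf)
  Dc := N.nextDc E tf

end Next

/-- The time distance based approximation graph `GRc~`. -/
def GRc : RootedGraph (DistClass P T) T where
  root := N.distInit
  step E tf E' := tf ∈ N.Ta E.M ∧ 0 ≤ N.distBeta E tf ∧ E' = N.distNext E tf

/-- Solutions of the approximated time distance system of a class of `GRc~`. -/
def distClassDSSol (E : DistClass P T) : Set ((ℕ → ℚ) × (T → ℚ)) :=
  N.distSol E.toFiringPoint ((E.DS E.n).map ofBound)

/-- Solutions of the exact time distance system of the sequence `S`. -/
def exactDSSol (S : List T) : Set ((ℕ → ℚ) × (T → ℚ)) :=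
  N.distSol (N.pointOf S) (N.exactDS S)

end ITPN

end

/-! Both inclusions are proved by carrying an invariant along the firing sequence, but the two
invariants are of different kinds.

Exact graph against `GRc`: every residual vector in a class of `GR` ends some timed run
(`path_GR_exists_run`), so it suffices to show that the computed coefficients bound every run.
Following a single run with its residual times at all points, `Sound` records these bounds together
with the history they depend on: a residual time is frozen between an inhibition and the next
activation, and decreases with the elapsed time while the transition is activated. Each candidate
inside a minimum then comes from splitting the quantity to be bounded into terms already bounded in
the current system or in an earlier one. `FiringStep.sound_next` checks this for one firing and
`TimedRun.exists_sound` iterates it. Firability in `GRc` follows because a residual vector from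
which `tf` fires first forces `distBeta` to be nonnegative. For the time distance systems, each
exact coefficient is a supremum over runs, hence at most any bound valid for all runs.

`GRc` against the DBM graph: no run is needed. Each expression of the DBM recursion occurs among the
candidates of the corresponding minimum in `GRc`, and the recursion is monotone, so coefficientwise
comparison (`Refines`) propagates. It gives the inclusion of solution sets and makes the firability
test of the DBM graph the weaker one. -/

namespace ITPN

/-! ### Bounds in `ℚ ∪ {∞}` -/

/-- The common shape of all coefficient estimates: the possibly infinite bounds are treated
termwise, which leaves an inequality in `ℚ` for linear arithmetic. -/
theorem coe_le_add {a b c : ℚ} {A B : WithTop ℚ} (ha : (a : WithTop ℚ) ≤ A)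
    (hb : (b : WithTop ℚ) ≤ B) (h : c ≤ a + b) : (c : WithTop ℚ) ≤ A + B :=
  (WithTop.coe_le_coe.2 h).trans (by rw [WithTop.coe_add]; exact add_le_add ha hb)

theorem coe_le_add₃ {a b d c : ℚ} {A B D : WithTop ℚ} (ha : (a : WithTop ℚ) ≤ A)
    (hb : (b : WithTop ℚ) ≤ B) (hd : (d : WithTop ℚ) ≤ D) (h : c ≤ a + b + d) :
    (c : WithTop ℚ) ≤ A + B + D :=
  coe_le_add (coe_le_add ha hb le_rfl) hd h

theorem coe_le_of_le {a c : ℚ} {A : WithTop ℚ} (ha : (a : WithTop ℚ) ≤ A) (h : c ≤ a) :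
    (c : WithTop ℚ) ≤ A :=
  (WithTop.coe_le_coe.2 h).trans ha

theorem ofRat_le_ofRat {a b : ℚ} : ofRat a ≤ ofRat b ↔ a ≤ b := by
  simp [ofRat]

theorem ofRat_le_ofBound {a : ℚ} {B : WithTop ℚ} : ofRat a ≤ ofBound B ↔ (a : WithTop ℚ) ≤ B := by
  induction B using WithTop.recTopCoe with
  | top => simp [ofBound]
  | coe b => rw [WithTop.coe_le_coe]; exact ofRat_le_ofRat

theorem elapsed_self (τ : ℕ → ℚ) (i : ℕ) : elapsed τ i i = 0 := by simp [elapsed]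

theorem elapsed_succ (τ : ℕ → ℚ) {i n : ℕ} (h : i ≤ n) :
    elapsed τ i (n + 1) = elapsed τ i n + τ (n + 1) := by
  unfold elapsed
  rw [Finset.sum_Ioc_succ_top h]

theorem elapsed_add (τ : ℕ → ℚ) {i j n : ℕ} (hij : i ≤ j) (hjn : j ≤ n) :
    elapsed τ i j + elapsed τ j n = elapsed τ i n :=
  Finset.sum_Ioc_consecutive τ hij hjn

theorem elapsed_congr {τ τ' : ℕ → ℚ} {m : ℕ} (h : ∀ k ∈ Finset.Icc 1 m, τ' k = τ k)
    {i n : ℕ} (hn : n ≤ m) : elapsed τ' i n = elapsed τ i n :=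
  Finset.sum_congr rfl fun k hk => h k (by simp only [Finset.mem_Ioc, Finset.mem_Icc] at *; omega)

variable {P T : Type*} [Fintype T] (N : ITPN P T)

/-! ### Markings and firing points -/

theorem Ta_subset_Te {M : P → ℕ} {t : T} (h : t ∈ N.Ta M) : t ∈ N.Te M := by
  classical
  unfold Ta at h
  exact (Finset.mem_filter.1 h).1

theorem mem_Ta {M : P → ℕ} {t : T} : t ∈ N.Ta M ↔ t ∈ N.Te M ∧ t ∉ N.Ti M := by
  classical
  unfold Ta
  exact Finset.mem_filter

theorem Te_of_persistent {M : P → ℕ} {tf t : T} (h : t ∈ N.Te (N.fire M tf))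
    (hn : t ∉ N.New M tf) : t ∈ N.Te M := by
  classical
  by_contra hc
  exact hn (by unfold New; exact Finset.mem_filter.2 ⟨h, Or.inl hc⟩)

theorem le_of_mem_Point {c : FiringPoint P T} {i : ℕ} (h : i ∈ N.Point c) : i ≤ c.n := by
  classical
  unfold Point at h
  have := (Finset.mem_filter.1 h).1
  rw [Finset.mem_range] at this
  omega

theorem pointOf_snoc (S : List T) (tf : T) :
    N.pointOf (S ++ [tf]) = N.nextPoint (N.pointOf S) tf := by
  simp [pointOf]

theorem pointOf_n (S : List T) : (N.pointOf S).n = S.length := by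
  induction S using List.reverseRecOn with
  | nil => rfl
  | append_singleton S t ih => rw [pointOf_snoc, List.length_append]; simp [nextPoint, ih]

/-- The class of the time distance based graph computed along `S`. -/
noncomputable def distOf (S : List T) : DistClass P T := S.foldl N.distNext N.distInit

theorem distOf_snoc (S : List T) (tf : T) :
    N.distOf (S ++ [tf]) = N.distNext (N.distOf S) tf := by
  simp [distOf]

theorem distOf_toFiringPoint (S : List T) : (N.distOf S).toFiringPoint = N.pointOf S := by
  induction S using List.reverseRecOn with
  | nil => rfl
  | append_singleton S t ih => rw [pointOf_snoc, distOf_snoc, ← ih]; rfl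

/-- The step relation is deterministic, so statements about arbitrary paths reduce to statements
about the fold `distOf S`. -/
theorem eq_distOf_of_path {S : List T} {E : DistClass P T} (h : N.GRc.Path S E) :
    E = N.distOf S := by
  induction h with
  | nil => rfl
  | snoc _ hs ih => rw [distOf_snoc, ← ih]; exact hs.2.2

/-- The class of the classical approximation computed along `S`. -/
noncomputable def dbmOf (S : List T) : DBMClass P T :=
  S.foldl (fun E tf => ⟨N.fire E.M tf, N.dbmNext E.M E.D tf⟩) ⟨N.M0, N.dbmInit⟩

theorem dbmOf_snoc (S : List T) (tf : T) :
    N.dbmOf (S ++ [tf]) =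
      ⟨N.fire (N.dbmOf S).M tf, N.dbmNext (N.dbmOf S).M (N.dbmOf S).D tf⟩ := by
  simp [dbmOf]

theorem eq_dbmOf_of_path {S : List T} {E : DBMClass P T} (h : N.GRdbm.Path S E) :
    E = N.dbmOf S := by
  induction h with
  | nil => rfl
  | snoc _ hs ih => rw [dbmOf_snoc, ← ih]; exact hs.2.2

/-! ### Timed runs and the exact graph -/

/-- The new solution set is the image of the old one under `Succ`, so a residual vector can be
traced back one step; the residual time of `tf` there is the missing firing distance. -/
theorem path_GR_exists_run {S : List T} {E : StateClass P T} (h : N.GR.Path S E) :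
    E.M = (N.pointOf S).M ∧ ∀ θ ∈ E.D, ∃ τ, N.TimedRun S τ θ := by
  classical
  induction h with
  | nil => exact ⟨rfl, fun θ hθ => ⟨0, TimedRun.nil 0 hθ⟩⟩
  | @snoc S E E' tf _ hs ih =>
    obtain ⟨htf, -, rfl⟩ := hs
    refine ⟨by rw [pointOf_snoc, ih.1]; rfl, ?_⟩
    rintro θ' ⟨θ, hθ, hsucc⟩
    obtain ⟨τ, hτ⟩ := ih.2 θ hθ
    rw [ih.1] at hsucc htf
    refine ⟨Function.update τ (S.length + 1) (θ tf), hτ.snoc htf hsucc ?_ (by simp)⟩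
    intro k hk
    rw [Finset.mem_Icc] at hk
    exact Function.update_of_ne (by omega) _ _

/-! ### Soundness of the time distance based approximation -/

/-- The class `E` bounds the run with firing time distances `τ` and residual times `Θ k` at the
firing points `k ≤ E.n`. -/
structure Sound (E : DistClass P T) (τ : ℕ → ℚ) (Θ : ℕ → T → ℚ) : Prop where
  ne_le : ∀ t ∈ N.Te E.M, E.Ne t ≤ E.n
  maxPt : ∀ i ≤ E.n, (elapsed τ i E.n : WithTop ℚ) ≤ (E.DS E.n).maxPt i
  minPt : ∀ i ≤ E.n, ((-elapsed τ i E.n : ℚ) : WithTop ℚ) ≤ (E.DS E.n).minPt i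
  maxTr : ∀ t ∈ N.Te E.M, ∀ k, E.Ne t ≤ k → k ≤ E.n → ∀ i ≤ k,
    ((elapsed τ i k + Θ k t : ℚ) : WithTop ℚ) ≤ (E.DS k).maxTr i t
  minTr : ∀ t ∈ N.Te E.M, ∀ k, E.Ne t ≤ k → k ≤ E.n → ∀ i ≤ k,
    ((-(elapsed τ i k + Θ k t) : ℚ) : WithTop ℚ) ≤ (E.DS k).minTr t i
  nonneg : ∀ t ∈ N.Te E.M, 0 ≤ Θ E.n t
  diff : ∀ t ∈ N.Te E.M, ∀ t' ∈ N.Te E.M, ((Θ E.n t' - Θ E.n t : ℚ) : WithTop ℚ) ≤ E.Dc t t'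
  inhibited : ∀ t ∈ N.Te E.M, t ∈ N.Ti E.M → ∃ s, E.Ni t = some s ∧ E.Ne t ≤ s ∧ s ≤ E.n ∧
    ∀ i, s ≤ i → i ≤ E.n → Θ i t = Θ E.n t
  activated : ∀ t ∈ N.Te E.M, t ∉ N.Ti E.M → ∃ p, E.Na t = some p ∧ E.Ne t ≤ p ∧ p ≤ E.n ∧
    Θ E.n t = Θ p t - elapsed τ p E.n ∧
    ∀ s, E.Ni t = some s → E.Ne t ≤ s ∧ ∀ i, s ≤ i → i ≤ p → Θ i t = Θ p t

/-! ### Consequences of soundness and the initial class -/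

namespace Sound

variable {N} {E : DistClass P T} {τ τ' : ℕ → ℚ} {Θ Θ' : ℕ → T → ℚ}

/-- Only data up to the point `E.n` matter, so a run may be prolonged without losing its bounds. -/
theorem congr (h : N.Sound E τ Θ) (hτ : ∀ k ∈ Finset.Icc 1 E.n, τ' k = τ k)
    (hΘ : ∀ k ≤ E.n, Θ' k = Θ k) : N.Sound E τ' Θ' where
  ne_le := h.ne_le
  maxPt i hi := by rw [elapsed_congr hτ le_rfl]; exact h.maxPt i hi
  minPt i hi := by rw [elapsed_congr hτ le_rfl]; exact h.minPt i hi
  maxTr t ht k h1 h2 i hi := by rw [elapsed_congr hτ h2, hΘ k h2]; exact h.maxTr t ht k h1 h2 i hi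
  minTr t ht k h1 h2 i hi := by rw [elapsed_congr hτ h2, hΘ k h2]; exact h.minTr t ht k h1 h2 i hi
  nonneg t ht := by rw [hΘ _ le_rfl]; exact h.nonneg t ht
  diff t ht t' ht' := by rw [hΘ _ le_rfl]; exact h.diff t ht t' ht'
  inhibited t ht hi := by
    obtain ⟨s, h1, h2, h3, h4⟩ := h.inhibited t ht hi
    refine ⟨s, h1, h2, h3, fun i hsi hin => ?_⟩
    rw [hΘ i hin, hΘ _ le_rfl]
    exact h4 i hsi hin
  activated t ht hi := by
    obtain ⟨p, h1, h2, h3, h4, h5⟩ := h.activated t ht hi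
    refine ⟨p, h1, h2, h3, ?_, fun s hs => ⟨(h5 s hs).1, fun i hsi hip => ?_⟩⟩
    · rw [elapsed_congr hτ le_rfl, hΘ _ le_rfl, hΘ p h3]; exact h4
    · rw [hΘ i (hip.trans h3), hΘ p h3]; exact (h5 s hs).2 i hsi hip

theorem maxNow (h : N.Sound E τ Θ) {t : T} (ht : t ∈ N.Te E.M) :
    (Θ E.n t : WithTop ℚ) ≤ (E.DS E.n).maxTr E.n t :=
  coe_le_of_le (h.maxTr t ht E.n (h.ne_le t ht) le_rfl E.n le_rfl) (by rw [elapsed_self]; linarith)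

theorem minNow (h : N.Sound E τ Θ) {t : T} (ht : t ∈ N.Te E.M) :
    ((-Θ E.n t : ℚ) : WithTop ℚ) ≤ (E.DS E.n).minTr t E.n :=
  coe_le_of_le (h.minTr t ht E.n (h.ne_le t ht) le_rfl E.n le_rfl) (by rw [elapsed_self]; linarith)

theorem mem_distClassSol (h : N.Sound E τ Θ) : Θ E.n ∈ N.distClassSol E :=
  ⟨fun _ ht => ⟨h.minNow ht, h.maxNow ht⟩, fun t ht t' ht' _ => h.diff t ht t' ht'⟩

theorem init {θ : T → ℚ} (hθ : θ ∈ N.initSol) (hΘ : Θ 0 = θ) : N.Sound N.distInit τ Θ := by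
  classical
  have hb : ∀ t ∈ N.Te N.M0, N.tmin t ≤ Θ 0 t ∧ (Θ 0 t : WithTop ℚ) ≤ N.tmax t := by
    rw [hΘ]; exact hθ
  have e0 : ∀ i, i ≤ 0 → elapsed τ i 0 = 0 := fun i hi => by
    rw [Nat.le_zero.1 hi, elapsed_self]
  refine ⟨fun _ _ => le_rfl, ?_, ?_, ?_, ?_, ?_, ?_, ?_, ?_⟩
  · intro i hi
    have := e0 i hi
    exact (congrArg ((↑) : ℚ → WithTop ℚ) this).le
  · intro i hi
    exact WithTop.coe_le_coe.2 (by rw [show elapsed τ i N.distInit.n = 0 from e0 i hi, neg_zero])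
  · intro t ht k _ hk i hi
    obtain rfl : k = 0 := Nat.le_zero.1 hk
    rw [e0 i hi, zero_add]
    exact (hb t ht).2
  · intro t ht k _ hk i hi
    obtain rfl : k = 0 := Nat.le_zero.1 hk
    rw [e0 i hi, zero_add]
    exact WithTop.coe_le_coe.2 (neg_le_neg (hb t ht).1)
  · intro t ht
    exact (N.tmin_nonneg t).trans (hb t ht).1
  · intro t ht t' ht'
    change ((Θ 0 t' - Θ 0 t : ℚ) : WithTop ℚ) ≤ if t = t' then 0 else _
    split_ifs with he
    · subst he; rw [sub_self]; exact le_rfl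
    · exact coe_le_add (hb t' ht').2 (WithTop.coe_le_coe.2 (neg_le_neg (hb t ht).1))
        (by linarith)
  · intro t ht hi
    refine ⟨0, if_pos hi, le_rfl, le_rfl, fun i _ hi' => ?_⟩
    rw [Nat.le_zero.1 hi']; rfl
  · intro t ht hi
    refine ⟨0, if_pos (N.mem_Ta.2 ⟨ht, hi⟩), le_rfl, le_rfl, ?_, fun s hs => ?_⟩
    · change Θ 0 t = Θ 0 t - elapsed τ 0 0
      rw [elapsed_self, sub_zero]
    -- A transition activated initially has no earlier inhibition, so the clause on `Ni` is vacuous.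
    · have hs' : (if t ∈ N.Ti N.M0 then some 0 else none) = some s := hs
      rw [if_neg (show t ∉ N.Ti N.M0 from hi)] at hs'
      cases hs'

end Sound

/-- Firing `tf` from the class `E` along the run with firing time distances `τ` and residual times
`Θ k` at the firing points `k ≤ E.n + 1`. -/
structure FiringStep (E : DistClass P T) (τ : ℕ → ℚ) (Θ : ℕ → T → ℚ) (tf : T) : Prop where
  sound : N.Sound E τ Θ
  mem : tf ∈ N.Ta E.M
  time : τ (E.n + 1) = Θ E.n tf
  first : ∀ t ∈ N.Ta E.M, Θ E.n tf ≤ Θ E.n t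
  new : ∀ t ∈ N.Te (N.fire E.M tf), t ∈ N.New E.M tf →
    N.tmin t ≤ Θ (E.n + 1) t ∧ (Θ (E.n + 1) t : WithTop ℚ) ≤ N.tmax t
  inhibited : ∀ t ∈ N.Te (N.fire E.M tf), t ∉ N.New E.M tf → t ∈ N.Ti E.M →
    Θ (E.n + 1) t = Θ E.n t
  activated : ∀ t ∈ N.Te (N.fire E.M tf), t ∉ N.New E.M tf → t ∉ N.Ti E.M →
    Θ (E.n + 1) t = Θ E.n t - Θ E.n tf

/-! ### Preservation of the bounds by one firing -/

namespace FiringStep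

variable {N} {E : DistClass P T} {τ : ℕ → ℚ} {Θ : ℕ → T → ℚ} {tf : T}

theorem of_succ (h : N.Sound E τ Θ) (htf : tf ∈ N.Ta E.M) (hτ : τ (E.n + 1) = Θ E.n tf)
    (hs : N.Succ E.M tf (Θ E.n) (Θ (E.n + 1))) : N.FiringStep E τ Θ tf where
  sound := h
  mem := htf
  time := hτ
  first := hs.1
  new t ht hn := by simpa [hn] using hs.2 t ht
  inhibited t ht hn hi := by simpa [hn, hi] using hs.2 t ht
  activated t ht hn hi := by simpa [hn, hi] using hs.2 t ht

theorem elapsed_next (h : N.FiringStep E τ Θ tf) {i : ℕ} (hi : i ≤ E.n) :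
    elapsed τ i (E.n + 1) = elapsed τ i E.n + Θ E.n tf := by
  rw [elapsed_succ τ hi, h.time]

theorem mem_Te (h : N.FiringStep E τ Θ tf) : tf ∈ N.Te E.M := N.Ta_subset_Te h.mem

theorem maxOld (h : N.FiringStep E τ Θ tf) {i : ℕ} (hi : i ≤ E.n) {t : T} (ht : t ∈ N.Te E.M) :
    ((elapsed τ i E.n + Θ E.n t : ℚ) : WithTop ℚ) ≤ (E.DS E.n).maxTr i t :=
  h.sound.maxTr t ht E.n (h.sound.ne_le t ht) le_rfl i hi

theorem minOld (h : N.FiringStep E τ Θ tf) {i : ℕ} (hi : i ≤ E.n) {t : T} (ht : t ∈ N.Te E.M) :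
    ((-(elapsed τ i E.n + Θ E.n t) : ℚ) : WithTop ℚ) ≤ (E.DS E.n).minTr t i :=
  h.sound.minTr t ht E.n (h.sound.ne_le t ht) le_rfl i hi

/-- No activated `t'` can have a residual time below that of `tf`, so each term of the minimum is a
bound. -/
theorem le_beta (h : N.FiringStep E τ Θ tf) {t : T} (ht : t ∈ N.Te E.M) :
    ((Θ E.n tf - Θ E.n t : ℚ) : WithTop ℚ) ≤ N.distBeta E t :=
  Finset.le_inf fun t' ht' =>
    coe_le_of_le (h.sound.diff t ht t' (N.Ta_subset_Te ht')) (by linarith [h.first t' ht'])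

theorem le_lambda (h : N.FiringStep E τ Θ tf) {i : ℕ} (hi : i ≤ E.n) :
    (elapsed τ i (E.n + 1) : WithTop ℚ) ≤ N.distLambda E i :=
  Finset.le_inf fun t' ht' =>
    coe_le_of_le (h.maxOld hi (N.Ta_subset_Te ht'))
      (by rw [h.elapsed_next hi]; linarith [h.first t' ht'])

theorem le_lambda_now (h : N.FiringStep E τ Θ tf) :
    (Θ E.n tf : WithTop ℚ) ≤ N.distLambda E E.n :=
  coe_le_of_le (h.le_lambda le_rfl) (by rw [h.elapsed_next le_rfl, elapsed_self]; linarith)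

theorem le_newMaxPt (h : N.FiringStep E τ Θ tf) {i : ℕ} (hi : i ≤ E.n + 1) :
    (elapsed τ i (E.n + 1) : WithTop ℚ) ≤ N.newMaxPt E i := by
  classical
  unfold newMaxPt
  split_ifs with he
  · subst he; rw [elapsed_self]; exact le_rfl
  · exact h.le_lambda (by omega)

theorem le_minTr_fired (h : N.FiringStep E τ Θ tf) {i : ℕ} (hi : i ≤ E.n) :
    ((-elapsed τ i (E.n + 1) : ℚ) : WithTop ℚ) ≤ (E.DS E.n).minTr tf i :=
  coe_le_of_le (h.minOld hi h.mem_Te) (by rw [h.elapsed_next hi])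

theorem le_newMinPt (h : N.FiringStep E τ Θ tf) {i : ℕ} (hi : i ≤ E.n + 1) :
    ((-elapsed τ i (E.n + 1) : ℚ) : WithTop ℚ) ≤ newMinPt E tf i := by
  classical
  unfold newMinPt
  split_ifs with he
  · subst he; rw [elapsed_self, neg_zero]; exact le_rfl
  · exact h.le_minTr_fired (by omega)

/-! ### Coefficients of persistent transitions -/

section Persistent

variable {t : T}

theorem Na_next (hn : t ∉ N.New E.M tf) (hi : t ∉ N.Ti E.M) :
    (N.nextPoint E.toFiringPoint tf).Na t = E.Na t := by
  simp [nextPoint, hn, hi]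

theorem Ni_next (hn : t ∉ N.New E.M tf) (hi : t ∈ N.Ti E.M) :
    (N.nextPoint E.toFiringPoint tf).Ni t = E.Ni t := by
  have : t ∉ N.Ta E.M := fun hc => (N.mem_Ta.1 hc).2 hi
  simp [nextPoint, hn, this]

/-- The residual time of `t` is frozen from its last inhibition `s` to its activation `p` and then
loses the time elapsed since `p`. Hence it equals its value at any point of `[s, p]` minus the time
from `p` to the new point. The reference point is `s` when `i ≤ s`, and `i` itself when `i` lies in
`[s, p]`. -/
theorem le_histMaxAct (h : N.FiringStep E τ Θ tf) (ht : t ∈ N.Te (N.fire E.M tf))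
    (hn : t ∉ N.New E.M tf) (hi : t ∉ N.Ti E.M) {i : ℕ} (hin : i ≤ E.n) :
    ((elapsed τ i (E.n + 1) + Θ (E.n + 1) t : ℚ) : WithTop ℚ) ≤ N.histMaxAct E tf i t := by
  have ht' := N.Te_of_persistent ht hn
  obtain ⟨p, hp, hnp, hpn, hΘp, hinh⟩ := h.sound.activated t ht' hi
  have e1 := h.activated t ht hn hi
  have e2 := h.elapsed_next hpn
  unfold histMaxAct
  rw [Na_next hn hi, hp]
  cases hNi : E.Ni t with
  | none => exact le_top
  | some s =>
    obtain ⟨hns, hconst⟩ := hinh s hNi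
    dsimp only
    split_ifs with h1 h2
    · refine coe_le_add₃ (h.sound.maxTr t ht' s hns (by omega) i h1.1) (h.le_lambda (by omega))
        (h.le_newMinPt (by omega)) ?_
      have e3 := hconst s le_rfl h1.2
      have e4 := elapsed_add τ h1.1 (show s ≤ E.n + 1 by omega)
      linarith
    · refine coe_le_add₃ (h.sound.maxTr t ht' i (by omega) hin i le_rfl)
        (h.le_newMaxPt (by omega)) (h.le_newMinPt (by omega)) ?_
      have e3 := hconst i h2.1 h2.2
      have e4 := elapsed_self τ i
      linarith
    · exact le_top

theorem le_histMinAct (h : N.FiringStep E τ Θ tf) (ht : t ∈ N.Te (N.fire E.M tf))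
    (hn : t ∉ N.New E.M tf) (hi : t ∉ N.Ti E.M) {i : ℕ} (hin : i ≤ E.n) :
    ((-(elapsed τ i (E.n + 1) + Θ (E.n + 1) t) : ℚ) : WithTop ℚ) ≤ N.histMinAct E tf i t := by
  have ht' := N.Te_of_persistent ht hn
  obtain ⟨p, hp, hnp, hpn, hΘp, hinh⟩ := h.sound.activated t ht' hi
  have e1 := h.activated t ht hn hi
  have e2 := h.elapsed_next hpn
  unfold histMinAct
  rw [Na_next hn hi, hp]
  cases hNi : E.Ni t with
  | none => exact le_top
  | some s =>
    obtain ⟨hns, hconst⟩ := hinh s hNi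
    dsimp only
    split_ifs with h1 h2
    · refine coe_le_add₃ (h.sound.minTr t ht' s hns (by omega) i h1.1)
        (h.le_minTr_fired (by omega)) (h.le_newMaxPt (by omega)) ?_
      have e3 := hconst s le_rfl h1.2
      have e4 := elapsed_add τ h1.1 (show s ≤ E.n + 1 by omega)
      linarith
    · refine coe_le_add₃ (h.sound.minTr t ht' i (by omega) hin i le_rfl)
        (h.le_newMinPt (by omega)) (h.le_newMaxPt (by omega)) ?_
      have e3 := hconst i h2.1 h2.2
      have e4 := elapsed_self τ i
      linarith
    · exact le_top

/-- Here the residual time has not moved since `s`, so only the time elapsed from the reference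
point, `s` or `i`, has to be added. -/
theorem le_histMaxInh (h : N.FiringStep E τ Θ tf) (ht : t ∈ N.Te (N.fire E.M tf))
    (hn : t ∉ N.New E.M tf) (hi : t ∈ N.Ti E.M) {i : ℕ} (hin : i ≤ E.n) :
    ((elapsed τ i (E.n + 1) + Θ (E.n + 1) t : ℚ) : WithTop ℚ) ≤ N.histMaxInh E tf i t := by
  have ht' := N.Te_of_persistent ht hn
  obtain ⟨s, hNi, hns, hsn, hconst⟩ := h.sound.inhibited t ht' hi
  have e1 := h.inhibited t ht hn hi
  unfold histMaxInh
  rw [Ni_next hn hi, hNi]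
  dsimp only
  split_ifs with h1
  · refine coe_le_add (h.sound.maxTr t ht' s hns hsn i h1) (h.le_newMaxPt (by omega)) ?_
    have e3 := hconst s le_rfl hsn
    have e4 := elapsed_add τ h1 (show s ≤ E.n + 1 by omega)
    linarith
  · refine coe_le_add (h.sound.maxTr t ht' i (by omega) hin i le_rfl)
      (h.le_newMaxPt (by omega)) ?_
    have e3 := hconst i (by omega) hin
    have e4 := elapsed_self τ i
    linarith

theorem le_histMinInh (h : N.FiringStep E τ Θ tf) (ht : t ∈ N.Te (N.fire E.M tf))
    (hn : t ∉ N.New E.M tf) (hi : t ∈ N.Ti E.M) {i : ℕ} (hin : i ≤ E.n) :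
    ((-(elapsed τ i (E.n + 1) + Θ (E.n + 1) t) : ℚ) : WithTop ℚ) ≤ N.histMinInh E tf i t := by
  have ht' := N.Te_of_persistent ht hn
  obtain ⟨s, hNi, hns, hsn, hconst⟩ := h.sound.inhibited t ht' hi
  have e1 := h.inhibited t ht hn hi
  unfold histMinInh
  rw [Ni_next hn hi, hNi]
  dsimp only
  split_ifs with h1
  · refine coe_le_add (h.sound.minTr t ht' s hns hsn i h1) (h.le_newMinPt (by omega)) ?_
    have e3 := hconst s le_rfl hsn
    have e4 := elapsed_add τ h1 (show s ≤ E.n + 1 by omega)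
    linarith
  · refine coe_le_add (h.sound.minTr t ht' i (by omega) hin i le_rfl)
      (h.le_newMinPt (by omega)) ?_
    have e3 := hconst i (by omega) hin
    have e4 := elapsed_self τ i
    linarith

/-- Justifies the candidate `0` in the minima for lower bounds: a running residual time stays
nonnegative because `tf` fires first. -/
theorem nonneg_next (h : N.FiringStep E τ Θ tf) (ht : t ∈ N.Te (N.fire E.M tf)) :
    0 ≤ Θ (E.n + 1) t := by
  by_cases hn : t ∈ N.New E.M tf
  · exact (N.tmin_nonneg t).trans (h.new t ht hn).1
  · have ht' := N.Te_of_persistent ht hn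
    by_cases hi : t ∈ N.Ti E.M
    · rw [h.inhibited t ht hn hi]; exact h.sound.nonneg t ht'
    · rw [h.activated t ht hn hi]
      exact sub_nonneg.2 (h.first t (N.mem_Ta.2 ⟨ht', hi⟩))

/-- While `t` is activated, elapsed time gains exactly what the residual time loses, so the old
bound on the sum survives. While `t` is inhibited, the sum grows by the firing delay, which
`distLambda` bounds. -/
theorem le_persMax (h : N.FiringStep E τ Θ tf) (ht : t ∈ N.Te (N.fire E.M tf))
    (hn : t ∉ N.New E.M tf) {i : ℕ} (hin : i ≤ E.n) :
    ((elapsed τ i (E.n + 1) + Θ (E.n + 1) t : ℚ) : WithTop ℚ) ≤ N.persMax E tf i t := by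
  classical
  have ht' := N.Te_of_persistent ht hn
  have e := h.elapsed_next hin
  unfold persMax
  split_ifs with hi
  · have e1 := h.inhibited t ht hn hi
    exact le_min (h.le_histMaxInh ht hn hi hin)
      (coe_le_add (h.maxOld hin ht') h.le_lambda_now (by linarith))
  · have e1 := h.activated t ht hn hi
    refine le_min (h.le_histMaxAct ht hn hi hin) (le_min
      (coe_le_of_le (h.maxOld hin ht') (by linarith)) (coe_le_add₃ (h.le_newMaxPt (by omega))
        (h.sound.maxNow ht') (h.sound.minNow h.mem_Te) (by linarith)))

theorem le_persMin (h : N.FiringStep E τ Θ tf) (ht : t ∈ N.Te (N.fire E.M tf))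
    (hn : t ∉ N.New E.M tf) {i : ℕ} (hin : i ≤ E.n) :
    ((-(elapsed τ i (E.n + 1) + Θ (E.n + 1) t) : ℚ) : WithTop ℚ) ≤ N.persMin E tf i t := by
  classical
  have ht' := N.Te_of_persistent ht hn
  have e := h.elapsed_next hin
  unfold persMin
  split_ifs with hi
  · have e1 := h.inhibited t ht hn hi
    exact le_min (h.le_histMinInh ht hn hi hin)
      (coe_le_add (h.minOld hin ht') (h.sound.minNow h.mem_Te) (by linarith))
  · have e1 := h.activated t ht hn hi
    have e2 := h.nonneg_next ht
    refine le_min (h.le_histMinAct ht hn hi hin) (le_min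
      (coe_le_of_le (h.minOld hin ht') (by linarith)) (coe_le_add (b := -Θ (E.n + 1) t)
        (h.le_newMinPt (by omega)) (le_min ?_ ?_) (by linarith)))
    · exact WithTop.coe_le_coe.2 (by linarith)
    · exact coe_le_add (h.sound.minNow ht') h.le_lambda_now (by linarith)

theorem le_persMaxNow (h : N.FiringStep E τ Θ tf) (ht : t ∈ N.Te (N.fire E.M tf))
    (hn : t ∉ N.New E.M tf) : (Θ (E.n + 1) t : WithTop ℚ) ≤ N.persMaxNow E tf t := by
  classical
  have ht' := N.Te_of_persistent ht hn
  have hne := h.sound.ne_le t ht'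
  have hdiff := h.sound.diff tf h.mem_Te t ht'
  -- The residual time is the date of `t` counted from its enabling point minus the time elapsed
  -- since that point.
  have hr : (Θ (E.n + 1) t : WithTop ℚ) ≤
      N.persMax E tf (E.Ne t) t + newMinPt E tf (E.Ne t) :=
    coe_le_add (h.le_persMax ht hn hne) (h.le_newMinPt (by omega)) (by linarith)
  unfold persMaxNow
  split_ifs with hi
  · have e1 := h.inhibited t ht hn hi
    exact le_min hr (le_min (coe_le_of_le (h.sound.maxNow ht') e1.le)
      (coe_le_add hdiff h.le_lambda_now (by linarith)))
  · exact le_min (coe_le_of_le hdiff (h.activated t ht hn hi).le) hr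

theorem le_persMinNow (h : N.FiringStep E τ Θ tf) (ht : t ∈ N.Te (N.fire E.M tf))
    (hn : t ∉ N.New E.M tf) : ((-Θ (E.n + 1) t : ℚ) : WithTop ℚ) ≤ N.persMinNow E tf t := by
  classical
  have ht' := N.Te_of_persistent ht hn
  have hne := h.sound.ne_le t ht'
  have hbeta := h.le_beta ht'
  have h0 : ((-Θ (E.n + 1) t : ℚ) : WithTop ℚ) ≤ 0 :=
    WithTop.coe_le_coe.2 (neg_nonpos.2 (h.nonneg_next ht))
  have hr : ((-Θ (E.n + 1) t : ℚ) : WithTop ℚ) ≤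
      N.persMin E tf (E.Ne t) t + N.newMaxPt E (E.Ne t) :=
    coe_le_add (h.le_persMin ht hn hne) (h.le_newMaxPt (by omega)) (by linarith)
  unfold persMinNow
  split_ifs with hi
  · have e1 := h.inhibited t ht hn hi
    exact le_min (le_min h0 hr) (le_min (coe_le_of_le (h.sound.minNow ht') (by linarith))
      (coe_le_add (h.sound.minNow h.mem_Te) hbeta (by linarith)))
  · have e1 := h.activated t ht hn hi
    exact le_min (coe_le_of_le hbeta (by linarith)) (le_min h0 hr)

end Persistent

theorem le_nextDS_maxTr (h : N.FiringStep E τ Θ tf) {t : T} (ht : t ∈ N.Te (N.fire E.M tf))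
    {i : ℕ} (hin : i ≤ E.n + 1) :
    ((elapsed τ i (E.n + 1) + Θ (E.n + 1) t : ℚ) : WithTop ℚ) ≤ (N.nextDS E tf).maxTr i t := by
  classical
  unfold nextDS
  dsimp only
  split_ifs with hn he
  · exact coe_le_add (h.le_newMaxPt hin) (h.new t ht hn).2 le_rfl
  · rw [he, elapsed_self, zero_add]; exact h.le_persMaxNow ht hn
  · exact h.le_persMax ht hn (by omega)

theorem le_nextDS_minTr (h : N.FiringStep E τ Θ tf) {t : T} (ht : t ∈ N.Te (N.fire E.M tf))
    {i : ℕ} (hin : i ≤ E.n + 1) :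
    ((-(elapsed τ i (E.n + 1) + Θ (E.n + 1) t) : ℚ) : WithTop ℚ) ≤
      (N.nextDS E tf).minTr t i := by
  classical
  unfold nextDS
  dsimp only
  split_ifs with hn he
  · exact coe_le_add (h.le_newMinPt hin) le_rfl (by linarith [(h.new t ht hn).1])
  · rw [he, elapsed_self, zero_add]; exact h.le_persMinNow ht hn
  · exact h.le_persMin ht hn (by omega)

/-- A difference of residual times changes only if exactly one of the two is running, and then by
the firing delay, with the sign depending on which one. -/
theorem le_distCross (h : N.FiringStep E τ Θ tf) {t t' : T} (ht : t ∈ N.Te (N.fire E.M tf))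
    (ht' : t' ∈ N.Te (N.fire E.M tf)) (hn : t ∉ N.New E.M tf) (hn' : t' ∉ N.New E.M tf) :
    ((Θ (E.n + 1) t' - Θ (E.n + 1) t : ℚ) : WithTop ℚ) ≤ N.distCross E tf t t' := by
  classical
  have hd := h.sound.diff t (N.Te_of_persistent ht hn) t' (N.Te_of_persistent ht' hn')
  unfold distCross
  by_cases hi : t ∈ N.Ti E.M <;> by_cases hi' : t' ∈ N.Ti E.M <;> simp only [hi, hi',
    not_true_eq_false, not_false_eq_true, and_true, and_false, if_true, if_false]
  · rw [h.inhibited t ht hn hi, h.inhibited t' ht' hn' hi']; exact hd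
  · rw [h.inhibited t ht hn hi, h.activated t' ht' hn' hi']
    exact coe_le_add hd (h.sound.minNow h.mem_Te) (by linarith)
  · rw [h.activated t ht hn hi, h.inhibited t' ht' hn' hi']
    exact coe_le_add hd h.le_lambda_now (by linarith)
  · rw [h.activated t ht hn hi, h.activated t' ht' hn' hi']
    exact coe_le_of_le hd (by linarith)

theorem le_nextDc (h : N.FiringStep E τ Θ tf) {t t' : T} (ht : t ∈ N.Te (N.fire E.M tf))
    (ht' : t' ∈ N.Te (N.fire E.M tf)) :
    ((Θ (E.n + 1) t' - Θ (E.n + 1) t : ℚ) : WithTop ℚ) ≤ N.nextDc E tf t t' := by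
  classical
  have hsum : ∀ i ≤ E.n + 1, ((Θ (E.n + 1) t' - Θ (E.n + 1) t : ℚ) : WithTop ℚ) ≤
      (N.nextDS E tf).maxTr i t' + (N.nextDS E tf).minTr t i := fun i hi =>
    coe_le_add (h.le_nextDS_maxTr ht' hi) (h.le_nextDS_minTr ht hi) (by linarith)
  unfold nextDc
  split_ifs with he hn
  · subst he; rw [sub_self]; exact le_rfl
  · exact hsum _ le_rfl
  · rw [not_or] at hn
    refine le_min (h.le_distCross ht ht' hn.1 hn.2) (Finset.le_inf fun i hi => hsum i ?_)
    rcases Finset.mem_insert.1 hi with rfl | hi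
    · exact le_rfl
    · exact N.le_of_mem_Point hi

/-- A new enabling discards all earlier points. Otherwise the earlier points belong to the same
enabling, and their bounds are inherited from the previous class. -/
theorem Ne_next_cases {t : T} (ht : t ∈ N.Te (N.fire E.M tf)) {k : ℕ}
    (hk : (N.distNext E tf).Ne t ≤ k) (hkn : k ≤ E.n + 1) :
    k = E.n + 1 ∨ k ≤ E.n ∧ t ∈ N.Te E.M ∧ E.Ne t ≤ k := by
  classical
  by_cases hn : t ∈ N.New E.M tf
  · have : (N.distNext E tf).Ne t = E.n + 1 := if_pos hn
    omega
  · have e : (N.distNext E tf).Ne t = E.Ne t := if_neg hn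
    have := N.Te_of_persistent ht hn
    rcases Nat.lt_or_ge E.n k with h1 | h1
    · exact Or.inl (by omega)
    · exact Or.inr ⟨h1, this, e ▸ hk⟩

theorem DS_next_new : (N.distNext E tf).DS (E.n + 1) = N.nextDS E tf := by
  simp [distNext]

theorem DS_next_old {k : ℕ} (hk : k ≤ E.n) : (N.distNext E tf).DS k = E.DS k :=
  Function.update_of_ne (by omega) _ _

theorem inhibited_next (h : N.FiringStep E τ Θ tf) {t : T} (ht : t ∈ N.Te (N.fire E.M tf))
    (hi : t ∈ N.Ti (N.fire E.M tf)) :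
    ∃ s, (N.distNext E tf).Ni t = some s ∧ (N.distNext E tf).Ne t ≤ s ∧ s ≤ E.n + 1 ∧
      ∀ i, s ≤ i → i ≤ E.n + 1 → Θ i t = Θ (E.n + 1) t := by
  classical
  -- If the inhibition starts at the new point, the interval of constancy is a single point.
  have key : (N.distNext E tf).Ne t ≤ E.n + 1 → (N.distNext E tf).Ni t = some (E.n + 1) →
      ∃ s, (N.distNext E tf).Ni t = some s ∧ (N.distNext E tf).Ne t ≤ s ∧ s ≤ E.n + 1 ∧
        ∀ i, s ≤ i → i ≤ E.n + 1 → Θ i t = Θ (E.n + 1) t := fun h1 h2 =>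
    ⟨_, h2, h1, le_rfl, fun i h3 h4 => by rw [le_antisymm h4 h3]⟩
  by_cases hn : t ∈ N.New E.M tf
  · exact key (by simp [distNext, nextPoint, hn]) (by simp [distNext, nextPoint, hn, hi])
  · have ht' := N.Te_of_persistent ht hn
    have hne := h.sound.ne_le t ht'
    by_cases hi' : t ∈ N.Ti E.M
    · obtain ⟨s, h1, h2, h3, h4⟩ := h.sound.inhibited t ht' hi'
      refine ⟨s, (Ni_next hn hi').trans h1, ?_, by omega, fun i hsi hin => ?_⟩
      · simpa [distNext, nextPoint, hn] using h2
      · rcases Nat.lt_or_ge E.n i with h5 | h5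
        · rw [show i = E.n + 1 by omega]
        · rw [h.inhibited t ht hn hi', h4 i hsi h5]
    · have := N.mem_Ta.2 ⟨ht', hi'⟩
      refine key ?_ ?_
      · simp only [distNext, nextPoint, hn, if_false]; omega
      · simp [distNext, nextPoint, hn, hi, this]

/-- When a persistent `t` leaves inhibition, the constancy required on `[s, p]` is the `inhibited`
clause of the previous class, extended by the firing that left its residual time unchanged. If `t`
was already activated, `p` stays and one more delay is subtracted. -/
theorem activated_next (h : N.FiringStep E τ Θ tf) {t : T} (ht : t ∈ N.Te (N.fire E.M tf))
    (hi : t ∉ N.Ti (N.fire E.M tf)) :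
    ∃ p, (N.distNext E tf).Na t = some p ∧ (N.distNext E tf).Ne t ≤ p ∧ p ≤ E.n + 1 ∧
      Θ (E.n + 1) t = Θ p t - elapsed τ p (E.n + 1) ∧
      ∀ s, (N.distNext E tf).Ni t = some s →
        (N.distNext E tf).Ne t ≤ s ∧ ∀ i, s ≤ i → i ≤ p → Θ i t = Θ p t := by
  classical
  have ha := N.mem_Ta.2 ⟨ht, hi⟩
  have e0 : Θ (E.n + 1) t = Θ (E.n + 1) t - elapsed τ (E.n + 1) (E.n + 1) := by
    rw [elapsed_self, sub_zero]
  by_cases hn : t ∈ N.New E.M tf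
  · exact ⟨E.n + 1, by simp [distNext, nextPoint, hn, ha], by simp [distNext, nextPoint, hn],
      le_rfl, e0, by simp [distNext, nextPoint, hn, hi]⟩
  · have ht' := N.Te_of_persistent ht hn
    have hne := h.sound.ne_le t ht'
    have eNe : (N.distNext E tf).Ne t = E.Ne t := if_neg hn
    have eNi : (N.distNext E tf).Ni t = E.Ni t := by simp [distNext, nextPoint, hn, hi]
    rw [eNe, eNi]
    by_cases hi' : t ∈ N.Ti E.M
    · obtain ⟨s, h1, h2, h3, h4⟩ := h.sound.inhibited t ht' hi'
      refine ⟨E.n + 1, by simp [distNext, nextPoint, hn, ha, hi'], by omega, le_rfl, e0, ?_⟩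
      intro s' hs'
      obtain rfl : s = s' := Option.some.inj (h1.symm.trans hs')
      refine ⟨h2, fun i hsi hin => ?_⟩
      rcases Nat.lt_or_ge E.n i with h5 | h5
      · rw [show i = E.n + 1 by omega]
      · rw [h.inhibited t ht hn hi', h4 i hsi h5]
    · obtain ⟨p, h1, h2, h3, h4, h5⟩ := h.sound.activated t ht' hi'
      refine ⟨p, (Na_next hn hi').trans h1, h2, by omega, ?_, h5⟩
      rw [h.activated t ht hn hi', h4, h.elapsed_next h3]
      ring

theorem sound_next (h : N.FiringStep E τ Θ tf) : N.Sound (N.distNext E tf) τ Θ := by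
  classical
  refine ⟨?_, ?_, ?_, ?_, ?_, ?_, ?_, fun t ht => h.inhibited_next ht,
    fun t ht => h.activated_next ht⟩
  · intro t ht
    change (if t ∈ N.New E.M tf then E.n + 1 else E.Ne t) ≤ E.n + 1
    split_ifs with hn
    · exact le_rfl
    · exact (h.sound.ne_le t (N.Te_of_persistent ht hn)).trans (Nat.le_succ _)
  · intro i hi
    change _ ≤ ((N.distNext E tf).DS (E.n + 1)).maxPt i
    rw [DS_next_new]
    exact h.le_newMaxPt hi
  · intro i hi
    change _ ≤ ((N.distNext E tf).DS (E.n + 1)).minPt i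
    rw [DS_next_new]
    exact h.le_newMinPt hi
  · intro t ht k hk hkn i hi
    rcases Ne_next_cases ht hk hkn with rfl | ⟨h1, h2, h3⟩
    · rw [DS_next_new]; exact h.le_nextDS_maxTr ht hi
    · rw [DS_next_old h1]; exact h.sound.maxTr t h2 k h3 h1 i hi
  · intro t ht k hk hkn i hi
    rcases Ne_next_cases ht hk hkn with rfl | ⟨h1, h2, h3⟩
    · rw [DS_next_new]; exact h.le_nextDS_minTr ht hi
    · rw [DS_next_old h1]; exact h.sound.minTr t h2 k h3 h1 i hi
  · intro t ht; exact h.nonneg_next ht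
  · intro t ht t' ht'; exact h.le_nextDc ht ht'

end FiringStep

/-! ### From timed runs to the exact graph -/

theorem TimedRun.exists_sound {N : ITPN P T} {S : List T} {τ : ℕ → ℚ} {θ : T → ℚ}
    (h : N.TimedRun S τ θ) :
    ∃ Θ : ℕ → T → ℚ, Θ (N.distOf S).n = θ ∧ N.Sound (N.distOf S) τ Θ := by
  classical
  induction h with
  | nil τ hθ => exact ⟨fun _ => _, rfl, Sound.init hθ rfl⟩
  | @snoc S tf τ τ' θ θ' _ htf hsucc hτ' hlast ih =>
    obtain ⟨Θ, hΘ, hsound⟩ := ih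
    -- Runs are indexed by `pointOf S` and `S.length`, classes by their own firing point; these two
    -- equations identify the indexings.
    have hp : (N.distOf S).toFiringPoint = N.pointOf S := N.distOf_toFiringPoint S
    have hlen : (N.distOf S).n = S.length := by rw [hp, pointOf_n]
    have hold : ∀ k ≤ (N.distOf S).n, Function.update Θ ((N.distOf S).n + 1) θ' k = Θ k :=
      fun k hk => Function.update_of_ne (by omega) _ _
    have hnew : Function.update Θ ((N.distOf S).n + 1) θ' ((N.distOf S).n + 1) = θ' := by simp
    rw [distOf_snoc]
    refine ⟨Function.update Θ ((N.distOf S).n + 1) θ', hnew,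
      (FiringStep.of_succ (hsound.congr (hlen ▸ hτ') hold) (hp ▸ htf) ?_ ?_).sound_next⟩
    · rw [hold _ le_rfl, hΘ, hlen, hlast]
    · rw [hold _ le_rfl, hΘ, hnew, hp]; exact hsucc

theorem mem_distClassSol_of_path {S : List T} {E : StateClass P T} (h : N.GR.Path S E) {θ : T → ℚ}
    (hθ : θ ∈ E.D) : θ ∈ N.distClassSol (N.distOf S) := by
  obtain ⟨τ, hτ⟩ := (N.path_GR_exists_run h).2 θ hθ
  obtain ⟨Θ, rfl, hs⟩ := hτ.exists_sound
  exact hs.mem_distClassSol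

/-- The minimum includes `tf` itself, and solution sets do not constrain diagonal entries, hence the
separate `hdiag`. -/
theorem distBeta_nonneg_of_firesFirst {E : DistClass P T} {tf : T} {θ : T → ℚ}
    (hθ : θ ∈ N.distClassSol E) (htf : tf ∈ N.Ta E.M) (hf : N.FiresFirst E.M tf θ)
    (hdiag : 0 ≤ E.Dc tf tf) : 0 ≤ N.distBeta E tf := by
  refine Finset.le_inf fun t ht => ?_
  by_cases he : tf = t
  · exact he ▸ hdiag
  · exact (WithTop.coe_le_coe.2 (sub_nonneg.2 (hf t ht))).trans
      (hθ.2 tf (N.Ta_subset_Te htf) t (N.Ta_subset_Te ht) he)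

theorem distOf_diag (S : List T) (t : T) : (N.distOf S).Dc t t = 0 := by
  classical
  induction S using List.reverseRecOn with
  | nil => exact if_pos rfl
  | append_singleton S tf _ => rw [distOf_snoc]; exact if_pos rfl

theorem path_GRc_of_path_GR {S : List T} {E : StateClass P T} (h : N.GR.Path S E) :
    N.GRc.Path S (N.distOf S) := by
  induction h with
  | nil => exact RootedGraph.Path.nil
  | @snoc S E E' tf hp hs ih =>
    obtain ⟨htf, ⟨θ, hθ, hf⟩, -⟩ := hs
    have hM : E.M = (N.distOf S).M := by
      rw [(N.path_GR_exists_run hp).1, distOf_toFiringPoint]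
    rw [hM] at htf hf
    exact ih.snoc ⟨htf, N.distBeta_nonneg_of_firesFirst (N.mem_distClassSol_of_path hp hθ) htf hf
      (N.distOf_diag S tf).ge, N.distOf_snoc S tf⟩

/-! ### Exact time distance systems -/

theorem le_supRuns {S : List T} {f : (ℕ → ℚ) → (T → ℚ) → ℚ} {τ : ℕ → ℚ} {θ : T → ℚ}
    (h : N.TimedRun S τ θ) : ofRat (f τ θ) ≤ N.supRuns S f :=
  le_iSup_of_le τ (le_iSup_of_le θ (le_iSup_of_le h le_rfl))

theorem supRuns_le {S : List T} {f : (ℕ → ℚ) → (T → ℚ) → ℚ} {b : WithTop ℚ}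
    (h : ∀ Θ τ, N.Sound (N.distOf S) τ Θ → (f τ (Θ S.length) : WithTop ℚ) ≤ b) :
    N.supRuns S f ≤ ofBound b := by
  refine iSup_le fun τ => iSup_le fun θ => iSup_le fun hr => ofRat_le_ofBound.2 ?_
  obtain ⟨Θ, rfl, hs⟩ := hr.exists_sound
  rw [distOf_toFiringPoint, pointOf_n]
  exact h Θ τ hs

/-- Comparison is coefficient by coefficient: an exact coefficient is a least upper bound over runs,
and soundness makes the approximate one an upper bound. -/
theorem exactDSSol_subset (S : List T) : N.exactDSSol S ⊆ N.distClassDSSol (N.distOf S) := by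
  have hp := N.distOf_toFiringPoint S
  have hn : (N.distOf S).n = S.length := by rw [hp, pointOf_n]
  rintro ⟨τ, θ⟩ hx
  unfold exactDSSol at hx
  rw [← hp] at hx
  refine ⟨fun i hi => ?_, fun i hi t ht => ?_⟩
  · have hin := N.le_of_mem_Point hi
    refine ⟨(hx.1 i hi).1.trans (N.supRuns_le fun Θ τ hs => ?_),
      (hx.1 i hi).2.trans (N.supRuns_le fun Θ τ hs => ?_)⟩
    · rw [← hn]; exact hs.minPt i hin
    · rw [← hn]; exact hs.maxPt i hin
  · have hin : i ≤ (N.distOf S).n := by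
      rcases Finset.mem_insert.1 hi with rfl | hi
      · exact le_rfl
      · exact N.le_of_mem_Point hi
    refine ⟨(hx.2 i hi t ht).1.trans (N.supRuns_le fun Θ τ hs => ?_),
      (hx.2 i hi t ht).2.trans (N.supRuns_le fun Θ τ hs => ?_)⟩
    · rw [← hn]; exact hs.minTr t ht _ (hs.ne_le t ht) le_rfl i hin
    · rw [← hn]; exact hs.maxTr t ht _ (hs.ne_le t ht) le_rfl i hin

theorem tmin_mem_initSol : N.tmin ∈ N.initSol := fun t _ => ⟨le_rfl, N.tmin_le_tmax t⟩

theorem distClassDSSol_init_subset : N.distClassDSSol N.distInit ⊆ N.exactDSSol [] := by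
  classical
  rintro ⟨τ, θ⟩ hx
  have hrun : N.TimedRun [] τ N.tmin := TimedRun.nil τ N.tmin_mem_initSol
  refine ⟨fun i hi => ?_, fun i hi t ht => ?_⟩
  · exact ⟨N.le_supRuns (f := fun τ _ => -elapsed τ i 0) hrun,
      N.le_supRuns (f := fun τ _ => elapsed τ i 0) hrun⟩
  · have hb := hx.2 i hi t ht
    obtain rfl : i = 0 := by
      rcases Finset.mem_insert.1 hi with rfl | hi
      · rfl
      · exact Nat.le_zero.1 (N.le_of_mem_Point hi)
    have h1 : ((-(elapsed τ 0 0 + θ t) : ℚ) : WithTop ℚ) ≤ ((-N.tmin t : ℚ) : WithTop ℚ) :=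
      ofRat_le_ofBound.1 hb.1
    have h2 : ((elapsed τ 0 0 + θ t : ℚ) : WithTop ℚ) ≤ N.tmax t := ofRat_le_ofBound.1 hb.2
    have h1' := WithTop.coe_le_coe.1 h1
    rw [elapsed_self, zero_add] at h1' h2
    constructor
    · refine le_trans (ofRat_le_ofRat.2 ?_)
        (N.le_supRuns (f := fun τ θ => -(elapsed τ 0 0 + θ t)) hrun)
      change -(elapsed τ 0 0 + θ t) ≤ -(elapsed τ 0 0 + N.tmin t)
      linarith
    -- Since `tmax t` may be infinite, no run need attain the supremum; it is enough to exhibit one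
    -- in which `t` has the residual time `θ t`.
    · have hmem : Function.update N.tmin t (θ t) ∈ N.initSol := by
        intro u _
        by_cases he : u = t
        · subst he; rw [Function.update_self]; exact ⟨by linarith, h2⟩
        · rw [Function.update_of_ne he]; exact ⟨le_rfl, N.tmin_le_tmax u⟩
      refine le_trans (ofRat_le_ofRat.2 ?_)
        (N.le_supRuns (f := fun τ θ => elapsed τ 0 0 + θ t) (TimedRun.nil τ hmem))
      change elapsed τ 0 0 + θ t ≤ elapsed τ 0 0 + Function.update N.tmin t (θ t) t
      rw [Function.update_self]

/-! ### The initial classes -/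

theorem initSol_eq_distClassSol : N.initSol = N.distClassSol N.distInit := by
  apply Set.Subset.antisymm
  · intro θ hθ
    exact (Sound.init (Θ := fun _ => θ) (τ := 0) hθ rfl).mem_distClassSol
  · intro θ hθ t ht
    exact ⟨neg_le_neg_iff.1 (WithTop.coe_le_coe.1 (hθ.1 t ht).1), (hθ.1 t ht).2⟩

theorem distClassSol_init_eq_dbmSol :
    N.distClassSol N.distInit = N.dbmSol N.M0 N.dbmInit := rfl

/-! ### Comparison with the classical approximation -/

/-- The coefficients of the time distance based class `E` are at most those of the DBM class `F`. -/
structure Refines (E : DistClass P T) (F : DBMClass P T) : Prop where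
  M_eq : E.M = F.M
  upper : ∀ t ∈ N.Te E.M, (E.DS E.n).maxTr E.n t ≤ F.D none (some t)
  lower : ∀ t ∈ N.Te E.M, (E.DS E.n).minTr t E.n ≤ F.D (some t) none
  cross : ∀ t ∈ N.Te E.M, ∀ t' ∈ N.Te E.M, E.Dc t t' ≤ F.D (some t) (some t')

namespace Refines

variable {N} {E : DistClass P T} {F : DBMClass P T}

theorem init : N.Refines N.distInit ⟨N.M0, N.dbmInit⟩ :=
  ⟨rfl, fun _ _ => le_rfl, fun _ _ => le_rfl, fun _ _ _ _ => le_rfl⟩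

theorem distClassSol_subset (h : N.Refines E F) : N.distClassSol E ⊆ N.dbmSol F.M F.D := by
  intro θ hθ
  rw [← h.M_eq]
  exact ⟨fun t ht => ⟨(hθ.1 t ht).1.trans (h.lower t ht), (hθ.1 t ht).2.trans (h.upper t ht)⟩,
    fun t ht t' ht' hne => (hθ.2 t ht t' ht' hne).trans (h.cross t ht t' ht')⟩

theorem beta_le (h : N.Refines E F) {t : T} (ht : t ∈ N.Te E.M) :
    N.distBeta E t ≤ N.dbmBeta F.M F.D (some t) := by
  unfold distBeta dbmBeta
  rw [← h.M_eq]
  exact Finset.inf_mono_fun fun t' ht' => h.cross t ht t' (N.Ta_subset_Te ht')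

theorem lambda_le (h : N.Refines E F) : N.distLambda E E.n ≤ N.dbmBeta F.M F.D none := by
  unfold distLambda dbmBeta
  rw [← h.M_eq]
  exact Finset.inf_mono_fun fun t' ht' => h.upper t' (N.Ta_subset_Te ht')

/-- Dropping the candidate through the enabling point leaves the DBM formula, with smaller
coefficients as input. -/
theorem nextDS_maxTr_le (h : N.Refines E F) {tf t : T} (htf : tf ∈ N.Te E.M)
    (ht : t ∈ N.Te (N.fire E.M tf)) :
    (N.nextDS E tf).maxTr (E.n + 1) t ≤ N.dbmUpper F.M F.D tf t := by
  classical
  unfold nextDS dbmUpper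
  rw [← h.M_eq]
  simp only [↓reduceIte]
  split_ifs with hn hi
  · simp [newMaxPt]
  · have ht' := N.Te_of_persistent ht hn
    unfold persMaxNow
    rw [if_pos hi]
    exact (min_le_right _ _).trans
      (min_le_min (h.upper t ht') (add_le_add (h.cross tf htf t ht') (h.M_eq ▸ h.lambda_le)))
  · unfold persMaxNow
    rw [if_neg hi]
    exact (min_le_left _ _).trans (h.cross tf htf t (N.Te_of_persistent ht hn))

theorem nextDS_minTr_le (h : N.Refines E F) {tf t : T} (htf : tf ∈ N.Te E.M)
    (ht : t ∈ N.Te (N.fire E.M tf)) :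
    (N.nextDS E tf).minTr t (E.n + 1) ≤ N.dbmLower F.M F.D tf t := by
  classical
  have h' := h.beta_le (t := t)
  unfold nextDS dbmLower
  rw [← h.M_eq] at h' ⊢
  simp only [↓reduceIte]
  split_ifs with hn hi
  · simp [newMinPt]
  · have ht' := N.Te_of_persistent ht hn
    unfold persMinNow
    rw [if_pos hi]
    exact (min_le_right _ _).trans
      (min_le_min (h.lower t ht') (add_le_add (h.lower tf htf) (h' ht')))
  · unfold persMinNow
    rw [if_neg hi]
    exact (min_le_left _ _).trans (h' (N.Te_of_persistent ht hn))

theorem distCross_le (h : N.Refines E F) {tf t t' : T} (htf : tf ∈ N.Te E.M) (ht : t ∈ N.Te E.M)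
    (ht' : t' ∈ N.Te E.M) : N.distCross E tf t t' ≤ N.dbmCross F.M F.D tf t t' := by
  classical
  have hl := h.lambda_le
  unfold distCross dbmCross
  rw [← h.M_eq] at hl ⊢
  split_ifs
  · exact add_le_add (h.cross t ht t' ht') (h.lower tf htf)
  · exact add_le_add (h.cross t ht t' ht') hl
  · exact h.cross t ht t' ht'

theorem next (h : N.Refines E F) {tf : T} (htf : tf ∈ N.Te E.M) :
    N.Refines (N.distNext E tf) ⟨N.fire F.M tf, N.dbmNext F.M F.D tf⟩ := by
  classical
  refine ⟨congrArg (fun M => N.fire M tf) h.M_eq, ?_, ?_, ?_⟩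
  · intro t ht
    change ((N.distNext E tf).DS (E.n + 1)).maxTr (E.n + 1) t ≤ _
    rw [FiringStep.DS_next_new]
    exact h.nextDS_maxTr_le htf ht
  · intro t ht
    change ((N.distNext E tf).DS (E.n + 1)).minTr t (E.n + 1) ≤ _
    rw [FiringStep.DS_next_new]
    exact h.nextDS_minTr_le htf ht
  · intro t ht t' ht'
    have hsum := add_le_add (h.nextDS_maxTr_le htf ht') (h.nextDS_minTr_le htf ht)
    change N.nextDc E tf t t' ≤ if t = t' then 0 else if t ∈ N.New F.M tf ∨ t' ∈ N.New F.M tf then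
      N.dbmUpper F.M F.D tf t' + N.dbmLower F.M F.D tf t else
      min (N.dbmCross F.M F.D tf t t') (N.dbmUpper F.M F.D tf t' + N.dbmLower F.M F.D tf t)
    unfold nextDc
    rw [← h.M_eq] at hsum ⊢
    split_ifs with he hn
    · exact le_rfl
    · exact hsum
    · rw [not_or] at hn
      -- The term of `distAlpha` at the current point is the sum of bounds used by the DBM
      -- recursion.
      refine min_le_min ?_ ((Finset.inf_le (Finset.mem_insert_self _ _)).trans hsum)
      have := h.distCross_le htf (N.Te_of_persistent ht hn.1) (N.Te_of_persistent ht' hn.2)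
      rwa [← h.M_eq] at this

end Refines

theorem path_GRdbm_of_path_GRc {S : List T} {E : DistClass P T} (h : N.GRc.Path S E) :
    N.GRdbm.Path S (N.dbmOf S) ∧ N.Refines E (N.dbmOf S) := by
  induction h with
  | nil => exact ⟨RootedGraph.Path.nil, Refines.init⟩
  | @snoc S E E' tf _ hs ih =>
    obtain ⟨htf, hb, rfl⟩ := hs
    have hTe := N.Ta_subset_Te htf
    rw [dbmOf_snoc]
    exact ⟨ih.1.snoc ⟨ih.2.M_eq ▸ htf, hb.trans (ih.2.beta_le hTe), rfl⟩, ih.2.next hTe⟩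

end ITPN

theorem theorem1 {P T : Type*} [Fintype T] (N : ITPN P T) :
    -- the initial systems coincide
    (N.GR.root.D = N.distClassSol N.GRc.root ∧
      N.distClassSol N.GRc.root = N.dbmSol N.GRdbm.root.M N.GRdbm.root.D ∧
      N.exactDSSol [] = N.distClassDSSol N.GRc.root) ∧
    -- the time distance based graph over-approximates the exact graph
    (∀ S : List T, N.GR.Firable S → N.GRc.Firable S) ∧
    (∀ (S : List T) (E : ITPN.StateClass P T) (Ec : ITPN.DistClass P T),
      N.GR.Path S E → N.GRc.Path S Ec →
        E.M = Ec.M ∧ N.pointOf S = Ec.toFiringPoint ∧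
        E.D ⊆ N.distClassSol Ec ∧ N.exactDSSol S ⊆ N.distClassDSSol Ec) ∧
    -- the classical DBM graph over-approximates the time distance based graph
    (∀ S : List T, N.GRc.Firable S → N.GRdbm.Firable S) ∧
    (∀ (S : List T) (Ec : ITPN.DistClass P T) (Ed : ITPN.DBMClass P T),
      N.GRc.Path S Ec → N.GRdbm.Path S Ed →
        Ec.M = Ed.M ∧ N.distClassSol Ec ⊆ N.dbmSol Ed.M Ed.D) := by
  refine ⟨⟨N.initSol_eq_distClassSol, N.distClassSol_init_eq_dbmSol,
    (N.exactDSSol_subset []).antisymm N.distClassDSSol_init_subset⟩, ?_, ?_, ?_, ?_⟩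
  · rintro S ⟨E, hE⟩
    exact ⟨_, N.path_GRc_of_path_GR hE⟩
  · intro S E Ec hE hc
    obtain rfl := N.eq_distOf_of_path hc
    refine ⟨?_, (N.distOf_toFiringPoint S).symm, fun θ hθ => N.mem_distClassSol_of_path hE hθ,
      N.exactDSSol_subset S⟩
    rw [(N.path_GR_exists_run hE).1, N.distOf_toFiringPoint]
  · rintro S ⟨E, hE⟩
    exact ⟨_, (N.path_GRdbm_of_path_GRc hE).1⟩
  · intro S Ec Ed hc hd
    obtain rfl := N.eq_dbmOf_of_path hd
    have h := (N.path_GRdbm_of_path_GRc hc).2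
    exact ⟨h.M_eq, h.distClassSol_subset⟩
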